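/- \textbf{Setting.} A network with routes of length one consists of a finite set $I=\{1,\dots,m\}$ ($m\ge 1$) of flow types, a finite set $J$ of resources with capacities $(C_j)_{j\in J}$, and for each $i\in I$ a nonempty set $J(i)\subseteq J$ of resources usable by type $i$. For $J'\subseteq J$ put $C(J')=\sum_{j\in J'}C_j$, $I(J')=\{i: J(i)\subseteq J'\}$ and $J^{-1}(J')=\{i: J(i)\cap J'\ne\emptyset\}$. A pair $(I',J')$ with $J'\neq\emptyset$ is connected if $J'$ cannot be partitioned into nonempty $J_1,J_2$ such that $I'$ can be partitioned into (possibly empty) $I_1,I_2$ with $J(i)\cap J_2=\emptyset$ for $i\in I_1$ and $J(i)\cap J_1=\emptyset$ for $i\in I_2$. A nonempty set $J'\subseteq J$ is connected, $J'\in\mathscr C(J)$, if $(I,J')$ is connected; it is strongly connected, $J'\in\mathscr{SC}(J)$, if $(I(J'),J')$ is connected. Let $U$ be a strictly concave, strictly increasing, differentiable utility function on $(0,\infty)$, extended to $0$ by its limit in $[-\infty,\infty)$. For $n\in[0,\infty)^I$ the rate allocation $x(n)$ is the vector $x$ that maximises $\sum_{i} n_iU(x_i)$ subject to $\sum_{i:\,j\in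 J(i)}n_ix_i^j\le C_j$ for all $j\in J$, $\sum_{j\in J(i)}x_i^j=x_i$ for all $i\in I$, and $x_i^j\ge0$, where $x_i=0$ if $n_i=0$. The clusters at $n$ are the pairs (set of flow types, set of resources) given by the connected components of the bipartite graph on $I\sqcup J$ in which $i$ and $j$ are adjacent if $x_i^j>0$ in some optimal solution. All flows of a cluster have the same rate $x_i(n)$, the rate of the cluster; a cluster without flow types (a single unused resource) is given the rate $+\infty$. The cluster levels are the unions of all clusters with the same rate, and they are numbered in increasing order of this rate. Let $\lambda_i,\mu_i,r_i>0$ and $\rho_i=\lambda_i/\mu_i$, and let the peak rates be ordered, $r_1\le r_2\le\dots\le r_m$; put $r_{m+1}=\infty$. The fluid limit of peak-rate constrained elastic traffic is $$n_i'(t)=\lambda_i-\mu_i\,n_i(t)\,\min\{x_i(n(t)),r_i\},\qquad i\in I,$$ and an equilibrium point is a vector $\hat n\ge0$ such that the constant path $n(t)\equiv\hat n$ is a solution. A flow type $i$ is peak-rate constrained at $\hat n$ if $r_i<x_i(\hat n)$. \textbf{Theorem.} Suppose that $$\sum_{i\in I(J')}\rho_i<C(J')\quad\text{for all }J'\in\mathscr{SC}(J),$$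 $$\sum_{i\in I'}\rho_i\neq C(J')\quad\text{for all }J'\in\mathscr C(J)\text{ and all }I'\text{ with }I(J')\subsetneq I'\subseteq J^{-1}(J').$$ Then the fluid limit has exactly one equilibrium point $\hat n$, and $\hat n$ and the rate allocation $\hat x=x(\hat n)$ are determined by the following algorithm. For $k=1,2,\dots$: \begin{itemize} \item find the minimum $$\hat x_k=\min_{i^*\in\{1,\dots,m\},\ J'\in\mathscr{SC}(J)}\ \frac{C(J')-\sum_{i\in I(J'),\,i>i^*}\rho_i}{\sum_{i\in I(J'),\,i\le i^*}\rho_i/r_i}$$ (a fraction with positive numerator and denominator $0$ being $+\infty$); \item let $J_k$ be the union of all strongly connected sets that achieve the minimum, and $I_k=I(J_k)$; \item let $i_k^*\in\{1,\dots,m\}$ be the unique index with $\hat x_k\in(r_{i_k^*},r_{i_k^*+1}]$; \item for $i\in I_k$ set $\hat x_i=\hat x_k$; for $i\in I_k$ with $i\le i_k^*$ set $\hat n_i=\rho_i/r_i$, and for $i\in I_k$ with $i>i_k^*$ set $\hat n_i=\rho_i/\hat x_k$; \item replace $I$ by $I\setminus I_k$, $J$ by $J\setminus J_k$ and each $J(i)$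 by $J(i)\setminus J_k$ (keeping the labels of the flow types), and repeat with the reduced network until no flow types and no resources are left. \end{itemize} The algorithm is well defined (in particular $i_k^*$ exists and is unique in every step) and stops after finitely many steps. Moreover $(I_k,J_k)$ is the $k$-th cluster level at $\hat n$, with rate $\hat x_k$, the $\hat x_k$ are strictly increasing, and these are all the cluster levels. Exactly the flow types in $I^*=\bigcup_k\{i\in I_k: i\le i_k^*\}$ are peak-rate constrained at $\hat n$. -/

import Mathlib

/-! Multipath networks with routes of length one: rate allocation, clusters, the fluid model of
peak-rate constrained elastic traffic, and the level-by-level algorithm. -/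

/-- The combinatorial part of a network with routes of length one: a set of users (flow types),
a set of resources, and for each user `i` the set `routes i` of the resources it can use. -/
structure Network (ι κ : Type*) where
  /-- the users `I` -/
  users : Finset ι
  /-- the resources `J` -/
  resources : Finset κ
  /-- the set `J(i)` of resources that user `i` can use -/
  routes : ι → Finset κ

namespace Network

variable {ι κ : Type*} [DecidableEq ι] [DecidableEq κ]

/-- `I(J') = {i : J(i) ⊆ J'}`, the users that have to go through `J'`. -/
def confined (N : Network ι κ) (J' : Finset κ) : Finset ι :=
  N.users.filter (fun i => N.routes i ⊆ J')

/-- `J⁻¹(J') = {i : J(i) ∩ J' ≠ ∅}`, the users that can use some resource of `J'`. -/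
def touching (N : Network ι κ) (J' : Finset κ) : Finset ι :=
  N.users.filter (fun i => (N.routes i ∩ J').Nonempty)

/-- The pair `(I', J')` is connected: `J'` is nonempty and it cannot be partitioned into nonempty
`J₁, J₂` such that `I'` can be partitioned into `I₁, I₂` with `J(i) ∩ J₂ = ∅` for `i ∈ I₁` and
`J(i) ∩ J₁ = ∅` for `i ∈ I₂`. -/
def ConnectedPair (N : Network ι κ) (I' : Finset ι) (J' : Finset κ) : Prop :=
  J'.Nonempty ∧
    ¬ ∃ (J₁ J₂ : Finset κ) (I₁ I₂ : Finset ι),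
        J₁.Nonempty ∧ J₂.Nonempty ∧ Disjoint J₁ J₂ ∧ J₁ ∪ J₂ = J' ∧
        Disjoint I₁ I₂ ∧ I₁ ∪ I₂ = I' ∧
        (∀ i ∈ I₁, N.routes i ∩ J₂ = ∅) ∧ (∀ i ∈ I₂, N.routes i ∩ J₁ = ∅)

/-- `J'` is a connected set of resources: `(I, J')` is connected. -/
def IsConn (N : Network ι κ) (J' : Finset κ) : Prop :=
  J' ⊆ N.resources ∧ N.ConnectedPair N.users J'

/-- `J'` is a strongly connected set of resources: `(I(J'), J')` is connected. -/
def IsStronglyConn (N : Network ι κ) (J' : Finset κ) : Prop :=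
  J' ⊆ N.resources ∧ N.ConnectedPair (N.confined J') J'

open Classical in
/-- The finite collection of the strongly connected sets of resources. -/
noncomputable def strongSets (N : Network ι κ) : Finset (Finset κ) :=
  N.resources.powerset.filter (fun J' => N.IsStronglyConn J')

/-- The network that is left when the resources `J₀` and the users `I(J₀)` are removed. -/
def remove (N : Network ι κ) (J₀ : Finset κ) : Network ι κ where
  users := N.users \ N.confined J₀
  resources := N.resources \ J₀
  routes := fun i => N.routes i \ J₀

/-- No users and no resources are left. -/
def Exhausted (N : Network ι κ) : Prop :=
  N.users = ∅ ∧ N.resources = ∅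

end Network

/-- The network in which all elements of `ι` are users and all elements of `κ` are resources. -/
def fullNetwork {ι κ : Type*} [Fintype ι] [Fintype κ] (S : ι → Finset κ) : Network ι κ where
  users := Finset.univ
  resources := Finset.univ
  routes := S

section Allocation

variable {ι κ : Type*} [Fintype ι] [Fintype κ] [DecidableEq κ]

/-- A utility function on the positive reals, extended to `0` by its limit there, which may be
`-∞` (as for the logarithm). -/
noncomputable def utilityExt (U : ℝ → ℝ) (x : ℝ) : EReal :=
  if 0 < x then (U x : EReal) else ⨅ y : Set.Ioi (0 : ℝ), (U y : EReal)

/-- The aggregate utility `∑ i, n i * U (x i)`. -/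
noncomputable def totalUtility (U : ℝ → ℝ) (n x : ι → ℝ) : EReal :=
  ∑ i, (n i : EReal) * utilityExt U (x i)

/-- Feasibility: `y i j` is the rate that a flow of type `i` receives from resource `j` and `x i`
is its total rate. -/
structure IsFeasible (C : κ → ℝ) (S : ι → Finset κ) (n x : ι → ℝ) (y : ι → κ → ℝ) : Prop where
  nonneg : ∀ i j, 0 ≤ y i j
  support : ∀ i j, j ∉ S i → y i j = 0
  capacity : ∀ j, ∑ i, n i * y i j ≤ C j
  total : ∀ i, ∑ j ∈ S i, y i j = x i

/-- `(x, y)` solves the utility maximisation problem when the numbers of flows are `n`, with the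
convention that `x i = 0` if `n i = 0`. -/
structure IsOptimal (U : ℝ → ℝ) (C : κ → ℝ) (S : ι → Finset κ) (n x : ι → ℝ)
    (y : ι → κ → ℝ) : Prop where
  feasible : IsFeasible C S n x y
  absent : ∀ i, n i = 0 → x i = 0
  optimal : ∀ x' y', IsFeasible C S n x' y' → totalUtility U n x' ≤ totalUtility U n x

open Classical in
/-- The rate allocation `x(n)`: the vector of total rates of a solution of the utility
maximisation problem (and `0` if there were no solution). -/
noncomputable def rateAllocation (U : ℝ → ℝ) (C : κ → ℝ) (S : ι → Finset κ) (n : ι → ℝ) :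
    ι → ℝ :=
  if h : ∃ x, ∃ y, IsOptimal U C S n x y then h.choose else 0

/-- The bipartite graph on users and resources with an edge between user `i` and resource `j` if
some solution of the utility maximisation problem at `n` sends traffic of `i` through `j`. -/
def flowGraph (U : ℝ → ℝ) (C : κ → ℝ) (S : ι → Finset κ) (n : ι → ℝ) : SimpleGraph (ι ⊕ κ) :=
  SimpleGraph.fromRel (fun a b =>
    ∃ i j, a = Sum.inl i ∧ b = Sum.inr j ∧ ∃ x y, IsOptimal U C S n x y ∧ 0 < y i j)

/-- `(I', J')` is a cluster at `n`: the users and resources of one connected component of the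
flow graph. -/
def IsCluster (U : ℝ → ℝ) (C : κ → ℝ) (S : ι → Finset κ) (n : ι → ℝ)
    (I' : Finset ι) (J' : Finset κ) : Prop :=
  ∃ v : ι ⊕ κ, (∀ i, i ∈ I' ↔ (flowGraph U C S n).Reachable v (Sum.inl i)) ∧
    (∀ j, j ∈ J' ↔ (flowGraph U C S n).Reachable v (Sum.inr j))

/-- `(I', J')` is a cluster at `n` and `v` is the common rate of its flows; a cluster without
flows has rate `+∞`. -/
def IsClusterOfRate (U : ℝ → ℝ) (C : κ → ℝ) (S : ι → Finset κ) (n : ι → ℝ) (v : EReal)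
    (I' : Finset ι) (J' : Finset κ) : Prop :=
  IsCluster U C S n I' J' ∧ (∀ i ∈ I', (rateAllocation U C S n i : EReal) = v) ∧
    (I' = ∅ → v = ⊤)

/-- `(I', J')` is the cluster level of rate `v` at `n`: there is a cluster of rate `v`, and
`(I', J')` is the union of all of them. -/
def IsClusterLevel (U : ℝ → ℝ) (C : κ → ℝ) (S : ι → Finset κ) (n : ι → ℝ) (v : EReal)
    (I' : Finset ι) (J' : Finset κ) : Prop :=
  (∃ A B, IsClusterOfRate U C S n v A B) ∧
    (∀ i, i ∈ I' ↔ ∃ A B, IsClusterOfRate U C S n v A B ∧ i ∈ A) ∧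
    (∀ j, j ∈ J' ↔ ∃ A B, IsClusterOfRate U C S n v A B ∧ j ∈ B)

/-- The right-hand side `λ_i - μ_i n_i min (x_i(n), r_i)` of the fluid dynamics. -/
noncomputable def fluidDrift (U : ℝ → ℝ) (C : κ → ℝ) (S : ι → Finset κ) (lam mu r : ι → ℝ)
    (n : ι → ℝ) : ι → ℝ :=
  fun i => lam i - mu i * n i * min (rateAllocation U C S n i) (r i)

/-- `z` is a (nonnegative) trajectory of the fluid limit, `z' = fluidDrift z` on `[0, ∞)`. -/
def IsFluidTrajectory (U : ℝ → ℝ) (C : κ → ℝ) (S : ι → Finset κ) (lam mu r : ι → ℝ)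
    (z : ℝ → ι → ℝ) : Prop :=
  ∀ t, 0 ≤ t → (∀ i, 0 ≤ z t i) ∧
    HasDerivWithinAt z (fluidDrift U C S lam mu r (z t)) (Set.Ici 0) t

/-- `n` is an equilibrium point of the fluid limit: the constant path at `n` is a trajectory. -/
def IsEquilibrium (U : ℝ → ℝ) (C : κ → ℝ) (S : ι → Finset κ) (lam mu r : ι → ℝ)
    (n : ι → ℝ) : Prop :=
  IsFluidTrajectory U C S lam mu r (fun _ => n)

end Allocation

section Algorithm

variable {m : ℕ} {κ : Type*} [Fintype κ] [DecidableEq κ]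

/-- The fraction
`(C(J') - ∑_{i ∈ I(J'), i > i*} ρ_i) / ∑_{i ∈ I(J'), i ≤ i*} ρ_i / r_i`
in the extended reals; a positive number divided by `0` is `+∞`. -/
noncomputable def peakRatio (C : κ → ℝ) (ρ r : Fin m → ℝ) (N : Network (Fin m) κ)
    (J' : Finset κ) (istar : Fin m) : EReal :=
  let num : ℝ := ∑ j ∈ J', C j - ∑ i ∈ (N.confined J').filter (fun i => istar < i), ρ i
  let den : ℝ := ∑ i ∈ (N.confined J').filter (fun i => i ≤ istar), ρ i / r i
  if den = 0 then (if 0 < num then ⊤ else ⊥) else ((num / den : ℝ) : EReal)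

/-- The minimum of the fractions over all `i*` and all strongly connected sets `J'`. -/
noncomputable def minRatio (C : κ → ℝ) (ρ r : Fin m → ℝ) (N : Network (Fin m) κ) : EReal :=
  (N.strongSets ×ˢ (Finset.univ : Finset (Fin m))).inf (fun p => peakRatio C ρ r N p.1 p.2)

open Classical in
/-- The union of all strongly connected sets that achieve the minimum. -/
noncomputable def minimizers (C : κ → ℝ) (ρ r : Fin m → ℝ) (N : Network (Fin m) κ) : Finset κ :=
  (N.strongSets.filter (fun J' => ∃ istar, peakRatio C ρ r N J' istar = minRatio C ρ r N)).biUnion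
    (fun J' => J')

/-- The network at the beginning of the step with number `k` (steps are counted from `0`). -/
noncomputable def networkAt (C : κ → ℝ) (ρ r : Fin m → ℝ) (S : Fin m → Finset κ) :
    ℕ → Network (Fin m) κ
  | 0 => fullNetwork S
  | k + 1 => (networkAt C ρ r S k).remove (minimizers C ρ r (networkAt C ρ r S k))

/-- The minimum found in step `k`. -/
noncomputable def levelRate (C : κ → ℝ) (ρ r : Fin m → ℝ) (S : Fin m → Finset κ) (k : ℕ) :
    EReal :=
  minRatio C ρ r (networkAt C ρ r S k)

/-- The set `J_k` of resources found in step `k`. -/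
noncomputable def levelResources (C : κ → ℝ) (ρ r : Fin m → ℝ) (S : Fin m → Finset κ) (k : ℕ) :
    Finset κ :=
  minimizers C ρ r (networkAt C ρ r S k)

/-- The set `I_k = I(J_k)` of users found in step `k`. -/
noncomputable def levelUsers (C : κ → ℝ) (ρ r : Fin m → ℝ) (S : Fin m → Finset κ) (k : ℕ) :
    Finset (Fin m) :=
  (networkAt C ρ r S k).confined (levelResources C ρ r S k)

/-- The peak rate that follows `r i` in the list, and `+∞` after the last one. -/
noncomputable def nextPeak (r : Fin m → ℝ) (i : Fin m) : EReal :=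
  if h : (i : ℕ) + 1 < m then (r ⟨(i : ℕ) + 1, h⟩ : EReal) else ⊤

/-- The algorithm stops after exactly `K` steps, the index `i*` with
`x_k ∈ (r_{i*}, r_{i*+1}]` exists and is unique in each step, its value being `istar k`, and the
algorithm returns the vector of rates `x` and the vector `n`. -/
structure IsAlgorithmOutput (C : κ → ℝ) (ρ r : Fin m → ℝ) (S : Fin m → Finset κ)
    (K : ℕ) (istar : ℕ → Fin m) (x n : Fin m → ℝ) : Prop where
  stops : (networkAt C ρ r S K).Exhausted
  continues : ∀ k < K, ¬ (networkAt C ρ r S k).Exhausted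
  threshold : ∀ k < K, ∀ i : Fin m,
    ((r i : EReal) < levelRate C ρ r S k ∧ levelRate C ρ r S k ≤ nextPeak r i) ↔ i = istar k
  rate : ∀ k < K, ∀ i ∈ levelUsers C ρ r S k, (x i : EReal) = levelRate C ρ r S k
  count_le : ∀ k < K, ∀ i ∈ levelUsers C ρ r S k, i ≤ istar k → n i = ρ i / r i
  count_gt : ∀ k < K, ∀ i ∈ levelUsers C ρ r S k, istar k < i →
    n i = ρ i / (levelRate C ρ r S k).toReal

end Algorithm

/-! At an equilibrium `n i * min (x i) (r i) = ρ i`, so the aggregate traffic `n i * x i` equals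
`peakLoad ρ r i (x i) = max (ρ i) (ρ i / r i * x i)`, a nondecreasing function of the rate alone.
For positive `n` and positive capacities, an allocation with positive rates is optimal exactly if it
is fair (`IsFairAllocation`): usable resources are full, and no flow uses a resource that a flow of
smaller rate could use. Exchange arguments give one direction, prices the other; the utility
function then plays no further role, and equilibria are fair allocations with loads given by
`peakLoad`.

Uniqueness (`equilibrium_rate_unique`): at the smallest rate where two equilibria differ, the users
up to that rate in one of them fill their resources. In the other equilibrium they have at least the
same rates and the same resources, hence the same loads. A load that is unchanged while the rate
grows equals `ρ i`, which produces full resources carrying exactly traffic `ρ`. Nondegeneracy,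
together with stability, forbids this (`not_critical`).

Existence and the algorithm: the minimum over `i*` linearises the maximum in `peakLoad`. A rate `v`
at least the first peak rate lies below all fractions of `J'` exactly if the load of `I(J')` at rate
`v` is at most `C(J')`, and it is then attained exactly if `J'` is tight (`forall_le_peakRatio_iff`,
`exists_peakRatio_eq_iff`). A finite minimum is thus the largest common rate that overloads no set.
Tight sets are closed under union, so the union of the minimisers is the largest tight set, and what
remains has strict slack: the reduced network is stable and its minimum is larger. Within each level
the absence of overload is Hall's condition for a transport problem (`exists_transport`), whose
solution fills the level. Users can reach no resource of a later level, so the combined routing is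
fair and therefore optimal.

Fairness also keeps every optimal routing inside the levels. Clusters therefore lie within levels,
and distinct levels have distinct rates. -/

set_option linter.unusedSectionVars false

/-! ### Tangent bounds for the extended utility function. -/

section Utility

variable {U : ℝ → ℝ}

theorem StrictConcaveOn.lt_tangent (hU : StrictConcaveOn ℝ (Set.Ioi 0) U)
    (hd : DifferentiableOn ℝ U (Set.Ioi 0)) {x v : ℝ} (hx : 0 < x) (hv : 0 < v) (hxv : x ≠ v) :
    U x < U v + derivWithin U (Set.Ioi 0) v * (x - v) := by
  rcases lt_or_gt_of_ne hxv with h | h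
  · have := hU.derivWithin_lt_slope (Set.mem_Ioi.2 hx) (Set.mem_Ioi.2 hv) h (hd v hv)
    rw [slope_def_field, lt_div_iff₀ (sub_pos.2 h)] at this
    linarith
  · have := hU.slope_lt_derivWithin (Set.mem_Ioi.2 hv) (Set.mem_Ioi.2 hx) h (hd v hv)
    rw [slope_def_field, div_lt_iff₀ (sub_pos.2 h)] at this
    linarith

theorem StrictConcaveOn.le_tangent (hU : StrictConcaveOn ℝ (Set.Ioi 0) U)
    (hd : DifferentiableOn ℝ U (Set.Ioi 0)) {x v : ℝ} (hx : 0 < x) (hv : 0 < v) :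
    U x ≤ U v + derivWithin U (Set.Ioi 0) v * (x - v) := by
  rcases eq_or_ne x v with rfl | h
  · simp
  · exact (hU.lt_tangent hd hx hv h).le

theorem utilityExt_of_pos {x : ℝ} (hx : 0 < x) : utilityExt U x = (U x : EReal) :=
  if_pos hx

/-- The extended utility function lies below its tangents, strictly away from the point of
contact. -/
theorem exists_utilityExt_le (hU : StrictConcaveOn ℝ (Set.Ioi 0) U)
    (hd : DifferentiableOn ℝ U (Set.Ioi 0)) {x v : ℝ} (hx : 0 ≤ x) (hv : 0 < v) :
    ∃ b : ℝ, utilityExt U x ≤ b ∧ b ≤ U v + derivWithin U (Set.Ioi 0) v * (x - v) ∧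
      (b = U v + derivWithin U (Set.Ioi 0) v * (x - v) → x = v) := by
  set p := derivWithin U (Set.Ioi 0)
  rcases hx.eq_or_lt with rfl | hx
  -- At zero, `b` is the intercept of the line through the graph at `v / 2` with the slope of `U` at
  -- `v`. By concavity this line dominates `U` on `(0, v / 2]` and lies strictly below the tangent
  -- at `v`.
  · have hv2 : 0 < v / 2 := by positivity
    have h1 : U (v / 2) < U v + p v * (v / 2 - v) := hU.lt_tangent hd hv2 hv (by linarith)
    have hb : U (v / 2) - p v * (v / 2) < U v + p v * (0 - v) := by linarith
    refine ⟨U (v / 2) - p v * (v / 2), ?_, hb.le, fun h => absurd h hb.ne⟩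
    have hanti := hU.strictAntiOn_derivWithin hd
    have hle : ∀ y, 0 < y → y ≤ v / 2 → U y ≤ U (v / 2) + p v * (y - v / 2) := by
      intro y hy hyv
      have h2 := hU.le_tangent hd hy hv2
      have h3 : p v < p (v / 2) := hanti (Set.mem_Ioi.2 hv2) (Set.mem_Ioi.2 hv) (by linarith)
      nlinarith
    rw [utilityExt, if_neg (lt_irrefl _)]
    refine EReal.le_of_forall_lt_iff_le.1 fun z hz => ?_
    have hz' : U (v / 2) - p v * (v / 2) < z := by exact_mod_cast hz
    -- Small enough for the gap between `z` and the intercept to absorb `|p v| * y`.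
    set y := min (v / 2) ((z - (U (v / 2) - p v * (v / 2))) / (|p v| + 1))
    have hy : 0 < y := lt_min hv2 (div_pos (sub_pos.2 hz') (by positivity))
    refine (iInf_le _ (⟨y, hy⟩ : Set.Ioi (0 : ℝ))).trans ?_
    have h4 := hle y hy (min_le_left _ _)
    have h5 : y * (|p v| + 1) ≤ z - (U (v / 2) - p v * (v / 2)) :=
      (le_div_iff₀ (by positivity)).1 (min_le_right _ _)
    have h6 := le_abs_self (p v)
    have : U y ≤ z := by nlinarith
    exact_mod_cast this
  · refine ⟨U x, (utilityExt_of_pos hx).le, hU.le_tangent hd hx hv, fun h => ?_⟩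
    by_contra hne
    exact (hU.lt_tangent hd hx hv hne).ne h

theorem EReal.coe_finset_sum {ι : Type*} (s : Finset ι) (f : ι → ℝ) :
    ((∑ i ∈ s, f i : ℝ) : EReal) = ∑ i ∈ s, (f i : EReal) := by
  classical
  induction s using Finset.induction_on with
  | empty => simp
  | insert a s ha ih => rw [Finset.sum_insert ha, Finset.sum_insert ha, EReal.coe_add, ih]

theorem totalUtility_of_pos {ι : Type*} [Fintype ι] {n x : ι → ℝ} (hx : ∀ i, 0 < x i) :
    totalUtility U n x = ((∑ i, n i * U (x i) : ℝ) : EReal) := by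
  simp only [totalUtility, utilityExt_of_pos (hx _), EReal.coe_finset_sum, EReal.coe_mul]

theorem totalUtility_le_coe {ι : Type*} [Fintype ι] {n x b : ι → ℝ} (hn : ∀ i, 0 ≤ n i)
    (hb : ∀ i, utilityExt U (x i) ≤ b i) :
    totalUtility U n x ≤ ((∑ i, n i * b i : ℝ) : EReal) := by
  simp only [totalUtility, EReal.coe_finset_sum, EReal.coe_mul]
  exact Finset.sum_le_sum fun i _ => mul_le_mul_of_nonneg_left (hb i) (by exact_mod_cast hn i)

end Utility

/-! ### Optimality conditions: optimal allocations with positive rates are the fair ones. -/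

section Fair

variable {ι κ : Type*} [Fintype ι] [Fintype κ] [DecidableEq κ]
  {U : ℝ → ℝ} {C : κ → ℝ} {S : ι → Finset κ} {n x : ι → ℝ} {y : ι → κ → ℝ}

/-- The optimality conditions of the utility maximisation problem for positive rates: usable
resources are saturated, and a flow only uses resources on which no usable alternative offers
a larger rate. -/
structure IsFairAllocation (C : κ → ℝ) (S : ι → Finset κ) (n x : ι → ℝ) (y : ι → κ → ℝ) :
    Prop where
  feasible : IsFeasible C S n x y
  pos : ∀ i, 0 < x i
  saturated : ∀ i, ∀ j ∈ S i, ∑ i', n i' * y i' j = C j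
  fair : ∀ i, ∀ j ∈ S i, ∀ i', 0 < y i' j → x i' ≤ x i

theorem IsFeasible.sum_rate (h : IsFeasible C S n x y) (i : ι) : ∑ j, y i j = x i := by
  rw [← h.total i]
  exact (Finset.sum_subset (Finset.subset_univ _) fun j _ hj => h.support i j hj).symm

/-- Increase the rate of `a` on resource `b` by `s` and decrease that of `a'` by `t`. -/
theorem IsFeasible.exchange [DecidableEq ι] (h : IsFeasible C S n x y) {a a' : ι} {b : κ}
    {s t : ℝ} (hs : 0 ≤ s) (hb : b ∈ S a) (ht : t ≤ y a' b) (ht0 : 0 ≤ t)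
    (hcap : ∑ i, n i * y i b + n a * s - n a' * t ≤ C b) :
    ∃ y', IsFeasible C S n
      (fun i => x i + (if i = a then s else 0) - (if i = a' then t else 0)) y' := by
  have hsum : ∀ j, ∑ i, n i * (y i j + (if i = a then (if j = b then s else 0) else 0)
      - (if i = a' then (if j = b then t else 0) else 0)) =
      ∑ i, n i * y i j + (if j = b then n a * s else 0) - (if j = b then n a' * t else 0) := by
    intro j
    simp only [mul_add, mul_sub, Finset.sum_add_distrib, Finset.sum_sub_distrib, mul_ite, mul_zero,
      Finset.sum_ite_eq', Finset.mem_univ, if_true]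
  refine ⟨fun i j => y i j + (if i = a then (if j = b then s else 0) else 0)
      - (if i = a' then (if j = b then t else 0) else 0), ?_, ?_, ?_, ?_⟩
  · intro i j
    have := h.nonneg i j
    by_cases hj : j = b
    · by_cases hi : i = a'
      · subst hi hj
        simp only [if_true]
        split_ifs <;> linarith
      · simp only [hi, if_false]
        split_ifs <;> linarith
    · simp [hj, this]
  · intro i j hj
    rw [h.support i j hj]
    by_cases hjb : j = b
    · subst hjb
      have h1 : i ≠ a := by rintro rfl; exact hj hb
      by_cases h2 : i = a'
      · subst h2
        have := h.support i j hj
        simp [h1]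
        linarith
      · simp [h1, h2]
    · simp [hjb]
  · intro j
    rw [hsum]
    by_cases hj : j = b
    · subst hj; simpa using hcap
    · simpa [hj] using h.capacity j
  · intro i
    simp only [Finset.sum_add_distrib, Finset.sum_sub_distrib, h.total]
    have h1 : ∑ j ∈ S i, (if i = a then (if j = b then s else 0) else 0) =
        if i = a then s else 0 := by
      split_ifs with hi
      · subst hi; simp [hb]
      · simp
    have h2 : ∑ j ∈ S i, (if i = a' then (if j = b then t else 0) else 0) =
        if i = a' then t else 0 := by
      split_ifs with hi
      · subst hi
        simp only [Finset.sum_ite_eq']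
        split_ifs with hbi
        · rfl
        · have := h.support i b hbi
          linarith
      · simp
    rw [h1, h2]

/-- Spare capacity could be given to a user, which raises the utility by monotonicity; traffic moved
from a richer to a poorer user on a common resource raises it by strict concavity. -/
theorem IsOptimal.isFairAllocation (hU : StrictConcaveOn ℝ (Set.Ioi 0) U)
    (hm : StrictMonoOn U (Set.Ioi 0)) (hn : ∀ i, 0 < n i) (hx : ∀ i, 0 < x i)
    (h : IsOptimal U C S n x y) : IsFairAllocation C S n x y := by
  classical
  refine ⟨h.feasible, hx, fun i j hj => ?_, fun i j hj i' hy => ?_⟩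
  · refine le_antisymm (h.feasible.capacity j) (le_of_not_gt fun hlt => ?_)
    set s := (C j - ∑ i', n i' * y i' j) / n i
    have hs : 0 < s := div_pos (sub_pos.2 hlt) (hn i)
    have hsn : n i * s = C j - ∑ i', n i' * y i' j := mul_div_cancel₀ _ (hn i).ne'
    obtain ⟨y', hy'⟩ := h.feasible.exchange (a' := i) (t := 0) hs.le hj
      (h.feasible.nonneg i j) le_rfl (by rw [hsn]; linarith)
    have hx' : ∀ k, x k ≤ x k + (if k = i then s else 0) - (if k = i then 0 else 0) := by
      intro k; split_ifs <;> linarith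
    have hopt := h.optimal _ _ hy'
    rw [totalUtility_of_pos hx, totalUtility_of_pos (fun k => (hx k).trans_le (hx' k)),
      EReal.coe_le_coe_iff] at hopt
    refine absurd hopt (not_le.2 (Finset.sum_lt_sum (fun k _ => ?_) ⟨i, Finset.mem_univ _, ?_⟩))
    · exact mul_le_mul_of_nonneg_left (hm.monotoneOn (Set.mem_Ioi.2 (hx k))
        (Set.mem_Ioi.2 ((hx k).trans_le (hx' k))) (hx' k)) (hn k).le
    · refine mul_lt_mul_of_pos_left (hm (Set.mem_Ioi.2 (hx i))
        (Set.mem_Ioi.2 ((hx i).trans_le (hx' i))) ?_) (hn i)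
      simp [hs]
  · by_contra! hlt
    have hne : i ≠ i' := by rintro rfl; exact lt_irrefl _ hlt
    -- `ε` is the amount of traffic moved; the rates per flow change by `ε / n i` and `ε / n i'`,
    -- little enough to leave the poorer user poorer.
    obtain ⟨ε, hε, hε1, hε2⟩ : ∃ ε > 0, ε / n i' ≤ y i' j ∧
        x i + ε / n i < x i' - ε / n i' := by
      set q := (n i)⁻¹ + (n i')⁻¹
      have hq : 0 < q := add_pos (inv_pos.2 (hn i)) (inv_pos.2 (hn i'))
      refine ⟨min (n i' * y i' j) ((x i' - x i) / (2 * q)), lt_min (mul_pos (hn i') hy)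
        (div_pos (sub_pos.2 hlt) (by positivity)), ?_, ?_⟩
      · rw [div_le_iff₀ (hn i'), mul_comm]
        exact min_le_left _ _
      · set ε := min (n i' * y i' j) ((x i' - x i) / (2 * q))
        have h1 : ε * (2 * q) ≤ x i' - x i := (le_div_iff₀ (by positivity)).1 (min_le_right _ _)
        have h2 : ε / n i + ε / n i' = ε * q := by
          rw [div_eq_mul_inv, div_eq_mul_inv, ← mul_add]
        linarith
    set s := ε / n i with hs_def
    set t := ε / n i' with ht_def
    have hs : 0 < s := div_pos hε (hn i)
    have ht : 0 < t := div_pos hε (hn i')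
    have hns : n i * s = ε := mul_div_cancel₀ _ (hn i).ne'
    have hnt : n i' * t = ε := mul_div_cancel₀ _ (hn i').ne'
    obtain ⟨y', hy'⟩ := h.feasible.exchange (a := i) (a' := i') (s := s) (t := t) hs.le hj hε1
      ht.le (by rw [hns, hnt]; linarith [h.feasible.capacity j])
    set x' : ι → ℝ := fun k => x k + (if k = i then s else 0) - (if k = i' then t else 0)
    have hxi : x' i = x i + s := by simp [x', hne]
    have hxi' : x' i' = x i' - t := by simp [x', hne.symm]
    have hxk : ∀ k, k ≠ i → k ≠ i' → x' k = x k := by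
      intro k h1 h2; simp [x', h1, h2]
    have hx' : ∀ k, 0 < x' k := by
      intro k
      by_cases h1 : k = i
      · subst h1; rw [hxi]; linarith [hx k]
      · by_cases h2 : k = i'
        · subst h2; rw [hxi']; linarith [hx i]
        · rw [hxk k h1 h2]; exact hx k
    have hopt := h.optimal _ _ hy'
    rw [totalUtility_of_pos hx, totalUtility_of_pos hx', EReal.coe_le_coe_iff] at hopt
    have hdiff : ∑ k, n k * U (x' k) - ∑ k, n k * U (x k) =
        n i * (U (x i + s) - U (x i)) + n i' * (U (x i' - t) - U (x i')) := by
      rw [← Finset.sum_sub_distrib]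
      rw [Finset.sum_eq_add i i' hne]
      · rw [hxi, hxi']; ring
      · rintro k - ⟨h1, h2⟩
        rw [hxk k h1 h2]; ring
      · simp
      · simp
    -- Slopes decrease over the three adjacent intervals cut out by `x i < x i + s < x i' - t < x
    -- i'`, so the gain of `i` outweighs the loss of `i'`.
    have h1 := hU.slope_anti_adjacent (Set.mem_Ioi.2 (hx i)) (z := x i' - t)
      (Set.mem_Ioi.2 (by linarith [hx i])) (show x i < x i + s by linarith) hε2
    have h2 := hU.slope_anti_adjacent (Set.mem_Ioi.2 (show 0 < x i + s by linarith [hx i]))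
      (Set.mem_Ioi.2 (hx i')) hε2 (show x i' - t < x i' by linarith)
    have h3 := h2.trans h1
    rw [show x i' - (x i' - t) = t by ring, show x i + s - x i = s by ring,
      div_lt_div_iff₀ ht hs, hs_def, ht_def, mul_div_assoc', mul_div_assoc',
      div_lt_div_iff₀ (hn i) (hn i')] at h3
    rw [← ht_def, ← hs_def] at h3
    have h4 : (U (x i') - U (x i' - t)) * n i' < (U (x i + s) - U (x i)) * n i := by
      have : ε * ((U (x i') - U (x i' - t)) * n i') < ε * ((U (x i + s) - U (x i)) * n i) := by
        linarith
      exact lt_of_mul_lt_mul_left this hε.le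
    linarith

namespace IsFairAllocation

theorem mem_of_pos (h : IsFairAllocation C S n x y) {i : ι} {j : κ} (hy : 0 < y i j) : j ∈ S i := by
  by_contra hj
  exact hy.ne' (h.feasible.support i j hj)

theorem exists_user (h : IsFairAllocation C S n x y) (hC : ∀ j, 0 < C j) {i : ι} {j : κ}
    (hj : j ∈ S i) : ∃ i', 0 < y i' j := by
  by_contra! hy
  have h0 : ∀ i', y i' j = 0 := fun i' => le_antisymm (hy i') (h.feasible.nonneg i' j)
  have := h.saturated i j hj
  simp only [h0, mul_zero, Finset.sum_const_zero] at this
  exact (hC j).ne this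

theorem exists_resource (h : IsFairAllocation C S n x y) (i : ι) : ∃ j ∈ S i, 0 < y i j := by
  by_contra! hy
  have := Finset.sum_nonpos hy
  rw [h.feasible.total] at this
  exact absurd (h.pos i) (not_lt.2 this)

theorem rate_eq (h : IsFairAllocation C S n x y) {i i' : ι} {j : κ} (hi : 0 < y i j)
    (hi' : 0 < y i' j) : x i = x i' :=
  le_antisymm (h.fair i' j (h.mem_of_pos hi') i hi) (h.fair i j (h.mem_of_pos hi) i' hi')

/-- The price of a resource is the marginal utility of the flows that use it. -/
theorem exists_price (h : IsFairAllocation C S n x y) (hC : ∀ j, 0 < C j)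
    (hU : StrictConcaveOn ℝ (Set.Ioi 0) U) (hm : StrictMonoOn U (Set.Ioi 0))
    (hd : DifferentiableOn ℝ U (Set.Ioi 0)) :
    ∃ q : κ → ℝ, (∀ j, 0 ≤ q j) ∧
      (∀ i, ∀ j ∈ S i, derivWithin U (Set.Ioi 0) (x i) ≤ q j) ∧
      (∀ i j, 0 < y i j → q j = derivWithin U (Set.Ioi 0) (x i)) ∧
      (∀ j, q j * C j = q j * ∑ i, n i * y i j) := by
  have hanti := hU.strictAntiOn_derivWithin hd
  have key : ∀ j, ∃ q : ℝ, 0 ≤ q ∧ (∀ i, j ∈ S i → derivWithin U (Set.Ioi 0) (x i) ≤ q) ∧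
      (∀ i, 0 < y i j → q = derivWithin U (Set.Ioi 0) (x i)) ∧
      q * C j = q * ∑ i, n i * y i j := by
    intro j
    by_cases hj : ∃ i, 0 < y i j
    · obtain ⟨i0, hi0⟩ := hj
      have hj0 := h.mem_of_pos hi0
      refine ⟨derivWithin U (Set.Ioi 0) (x i0), ?_, fun i hi => ?_, fun i hi => ?_, ?_⟩
      · exact hm.monotoneOn.derivWithin_nonneg
      · exact hanti.antitoneOn (Set.mem_Ioi.2 (h.pos i0)) (Set.mem_Ioi.2 (h.pos i))
          (h.fair i j hi i0 hi0)
      · rw [h.rate_eq hi hi0]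
      · rw [h.saturated i0 j hj0]
    -- A resource that carries no traffic is usable by nobody, because usable resources are full.
    -- Price zero is then consistent.
    · refine ⟨0, le_rfl, fun i hi => absurd (h.exists_user hC hi) hj,
        fun i hi => absurd ⟨i, hi⟩ hj, by simp⟩
  choose q h1 h2 h3 h4 using key
  exact ⟨q, h1, fun i j hj => h2 j i hj, fun i j hj => h3 j i hj, h4⟩

/-- Lagrangian duality: the prices `q` show that `x` maximises the linearised utility at `x`, and
concavity puts the true utility below its linearisation. Equality forces contact with every tangent,
hence equal rates. -/
theorem totalUtility_le (h : IsFairAllocation C S n x y) (hC : ∀ j, 0 < C j) (hn : ∀ i, 0 < n i)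
    (hU : StrictConcaveOn ℝ (Set.Ioi 0) U) (hm : StrictMonoOn U (Set.Ioi 0))
    (hd : DifferentiableOn ℝ U (Set.Ioi 0)) {x' : ι → ℝ} {y' : ι → κ → ℝ}
    (h' : IsFeasible C S n x' y') :
    totalUtility U n x' ≤ totalUtility U n x ∧
      (totalUtility U n x' = totalUtility U n x → x' = x) := by
  set p := derivWithin U (Set.Ioi 0)
  obtain ⟨q, hq0, hq1, hq2, hq3⟩ := h.exists_price hC hU hm hd
  have hx' : ∀ i, 0 ≤ x' i := fun i => by
    rw [← h'.total]; exact Finset.sum_nonneg fun j _ => h'.nonneg i j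
  have hlin : ∑ i, n i * (p (x i) * x' i) ≤ ∑ i, n i * (p (x i) * x i) := by
    calc ∑ i, n i * (p (x i) * x' i) = ∑ i, ∑ j, n i * (p (x i) * y' i j) := by
          refine Finset.sum_congr rfl fun i _ => ?_
          rw [← h'.sum_rate i, Finset.mul_sum, Finset.mul_sum]
      _ ≤ ∑ i, ∑ j, n i * (q j * y' i j) := by
          refine Finset.sum_le_sum fun i _ => Finset.sum_le_sum fun j _ =>
            mul_le_mul_of_nonneg_left ?_ (hn i).le
          by_cases hj : j ∈ S i
          · exact mul_le_mul_of_nonneg_right (hq1 i j hj) (h'.nonneg i j)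
          · simp [h'.support i j hj]
      _ = ∑ j, q j * ∑ i, n i * y' i j := by
          rw [Finset.sum_comm]
          refine Finset.sum_congr rfl fun j _ => ?_
          rw [Finset.mul_sum]
          exact Finset.sum_congr rfl fun i _ => by ring
      _ ≤ ∑ j, q j * C j :=
          Finset.sum_le_sum fun j _ => mul_le_mul_of_nonneg_left (h'.capacity j) (hq0 j)
      _ = ∑ j, q j * ∑ i, n i * y i j := Finset.sum_congr rfl fun j _ => hq3 j
      _ = ∑ i, ∑ j, n i * (q j * y i j) := by
          rw [Finset.sum_comm]
          refine Finset.sum_congr rfl fun j _ => ?_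
          rw [Finset.mul_sum]
          exact Finset.sum_congr rfl fun i _ => by ring
      _ = ∑ i, ∑ j, n i * (p (x i) * y i j) := by
          refine Finset.sum_congr rfl fun i _ => Finset.sum_congr rfl fun j _ => ?_
          rcases (h.feasible.nonneg i j).eq_or_lt with h0 | h0
          · simp [← h0]
          · rw [hq2 i j h0]
      _ = ∑ i, n i * (p (x i) * x i) := by
          refine Finset.sum_congr rfl fun i _ => ?_
          rw [← Finset.mul_sum, ← Finset.mul_sum, h.feasible.sum_rate]
  choose b hb1 hb2 hb3 using fun i => exists_utilityExt_le hU hd (hx' i) (h.pos i)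
  have hle := totalUtility_le_coe (U := U) (fun i => (hn i).le) hb1
  have htan : ∑ i, n i * (U (x i) + p (x i) * (x' i - x i)) ≤ ∑ i, n i * U (x i) := by
    have : ∑ i, n i * (U (x i) + p (x i) * (x' i - x i)) = ∑ i, n i * U (x i) +
        (∑ i, n i * (p (x i) * x' i) - ∑ i, n i * (p (x i) * x i)) := by
      rw [← Finset.sum_sub_distrib, ← Finset.sum_add_distrib]
      exact Finset.sum_congr rfl fun i _ => by ring
    linarith
  have hbt : ∑ i, n i * b i ≤ ∑ i, n i * (U (x i) + p (x i) * (x' i - x i)) :=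
    Finset.sum_le_sum fun i _ => mul_le_mul_of_nonneg_left (hb2 i) (hn i).le
  rw [totalUtility_of_pos h.pos]
  refine ⟨hle.trans (EReal.coe_le_coe_iff.2 (hbt.trans htan)), fun heq => ?_⟩
  rw [heq, EReal.coe_le_coe_iff] at hle
  by_contra hne
  obtain ⟨i, hi⟩ := Function.ne_iff.1 hne
  have : ∑ i, n i * b i < ∑ i, n i * (U (x i) + p (x i) * (x' i - x i)) :=
    Finset.sum_lt_sum (fun i _ => mul_le_mul_of_nonneg_left (hb2 i) (hn i).le)
      ⟨i, Finset.mem_univ _, mul_lt_mul_of_pos_left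
        (lt_of_le_of_ne (hb2 i) fun h => hi (hb3 i h)) (hn i)⟩
  linarith

theorem isOptimal (h : IsFairAllocation C S n x y) (hC : ∀ j, 0 < C j) (hn : ∀ i, 0 < n i)
    (hU : StrictConcaveOn ℝ (Set.Ioi 0) U) (hm : StrictMonoOn U (Set.Ioi 0))
    (hd : DifferentiableOn ℝ U (Set.Ioi 0)) : IsOptimal U C S n x y :=
  ⟨h.feasible, fun i hi => absurd hi (hn i).ne',
    fun _ _ h' => (h.totalUtility_le hC hn hU hm hd h').1⟩

theorem rate_unique (h : IsFairAllocation C S n x y) (hC : ∀ j, 0 < C j) (hn : ∀ i, 0 < n i)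
    (hU : StrictConcaveOn ℝ (Set.Ioi 0) U) (hm : StrictMonoOn U (Set.Ioi 0))
    (hd : DifferentiableOn ℝ U (Set.Ioi 0)) {x' : ι → ℝ} {y' : ι → κ → ℝ}
    (h' : IsOptimal U C S n x' y') : x' = x := by
  have h1 := h.totalUtility_le hC hn hU hm hd h'.feasible
  exact h1.2 (le_antisymm h1.1 (h'.optimal _ _ h.feasible))

theorem rateAllocation_eq (h : IsFairAllocation C S n x y) (hC : ∀ j, 0 < C j)
    (hn : ∀ i, 0 < n i) (hU : StrictConcaveOn ℝ (Set.Ioi 0) U) (hm : StrictMonoOn U (Set.Ioi 0))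
    (hd : DifferentiableOn ℝ U (Set.Ioi 0)) : rateAllocation U C S n = x := by
  have hex : ∃ x, ∃ y, IsOptimal U C S n x y := ⟨x, y, h.isOptimal hC hn hU hm hd⟩
  rw [rateAllocation, dif_pos hex]
  obtain ⟨y', hy'⟩ := hex.choose_spec
  exact h.rate_unique hC hn hU hm hd hy'

end IsFairAllocation

end Fair

/-! ### A Hall-type theorem for fractional transport. -/

section Transport

variable {ι κ : Type*} [Fintype ι] [Fintype κ] [DecidableEq κ]

/-- Among all ways to serve the demands `d`, one that minimises `∑ j, load j ^ 2 / C j` balances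
the relative loads. -/
theorem exists_balanced_transport {C : κ → ℝ} (hC : ∀ j, 0 < C j) {T : ι → Finset κ}
    (hT : ∀ i, (T i).Nonempty) {d : ι → ℝ} (hd : ∀ i, 0 ≤ d i) :
    ∃ z : ι → κ → ℝ, (∀ i j, 0 ≤ z i j) ∧ (∀ i j, j ∉ T i → z i j = 0) ∧
      (∀ i, ∑ j ∈ T i, z i j = d i) ∧
      ∀ i j j', 0 < z i j → j' ∈ T i → (∑ k, z k j) / C j ≤ (∑ k, z k j') / C j' := by
  classical
  set K : Set (ι → κ → ℝ) := {z | (∀ i j, 0 ≤ z i j) ∧ (∀ i j, j ∉ T i → z i j = 0) ∧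
    ∀ i, ∑ j ∈ T i, z i j = d i}
  have hle : ∀ z ∈ K, ∀ i j, z i j ≤ d i := by
    rintro z ⟨h0, h1, h2⟩ i j
    by_cases hj : j ∈ T i
    · rw [← h2 i]; exact Finset.single_le_sum (fun j _ => h0 i j) hj
    · rw [h1 i j hj]; exact hd i
  have hclosed : IsClosed K := by
    simp only [K, Set.ofPred_and, Set.ofPred_forall]
    refine IsClosed.inter ?_ (IsClosed.inter ?_ ?_)
    · exact isClosed_iInter fun i => isClosed_iInter fun j =>
        isClosed_le continuous_const (by fun_prop)
    · exact isClosed_iInter fun i => isClosed_iInter fun j => isClosed_iInter fun _ =>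
        isClosed_eq (by fun_prop) continuous_const
    · exact isClosed_iInter fun i => isClosed_eq (by fun_prop) continuous_const
  have hcompact : IsCompact K :=
    (isCompact_Icc (a := (0 : ι → κ → ℝ)) (b := fun i _ => d i)).of_isClosed_subset hclosed
      fun z hz => ⟨fun i j => hz.1 i j, fun i j => hle z hz i j⟩
  have hne : K.Nonempty := by
    choose t ht using hT
    refine ⟨fun i j => if j = t i then d i else 0, fun i j => ?_, fun i j hj => ?_, fun i => ?_⟩
    · dsimp only; split_ifs <;> simp [hd]
    · exact if_neg (by rintro rfl; exact hj (ht i))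
    · simp [ht]
  obtain ⟨z, ⟨h0, h1, h2⟩, hmin⟩ := hcompact.exists_isMinOn hne
    (f := fun z => ∑ j, (∑ k, z k j) ^ 2 / C j) (by fun_prop)
  refine ⟨z, h0, h1, h2, fun i j j' hz hj' => ?_⟩
  by_contra! hlt
  have hjj : j' ≠ j := by rintro rfl; exact lt_irrefl _ hlt
  have hj : j ∈ T i := by by_contra hj; exact hz.ne' (h1 i j hj)
  set q := (C j)⁻¹ + (C j')⁻¹
  have hq : 0 < q := add_pos (inv_pos.2 (hC j)) (inv_pos.2 (hC j'))
  set g := (∑ k, z k j) / C j - (∑ k, z k j') / C j' with hg_def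
  have hg : 0 < g := sub_pos.2 hlt
  obtain ⟨ε, hε, hε1, hε2⟩ : ∃ ε > 0, ε ≤ z i j ∧ ε * q ≤ g :=
    ⟨min (z i j) (g / q), lt_min hz (div_pos hg hq), min_le_left _ _,
      (le_div_iff₀ hq).1 (min_le_right _ _)⟩
  set z' : ι → κ → ℝ := fun a k => z a k + ((if a = i then (if k = j' then ε else 0) else 0)
    - (if a = i then (if k = j then ε else 0) else 0)) with hz'_def
  have hz' : z' ∈ K := by
    refine ⟨fun a k => ?_, fun a k hk => ?_, fun a => ?_⟩
    · have := h0 a k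
      by_cases ha : a = i
      · subst ha
        by_cases hk : k = j
        · subst hk; simp [z', hjj.symm]; linarith
        · simp only [z', hk, if_true, if_false]; split_ifs <;> linarith
      · simpa [z', ha] using this
    · by_cases ha : a = i
      · subst ha
        have hk1 : k ≠ j := by rintro rfl; exact hk hj
        have hk2 : k ≠ j' := by rintro rfl; exact hk hj'
        simp [z', hk1, hk2, h1 a k hk]
      · simp [z', ha, h1 a k hk]
    · by_cases ha : a = i
      · subst ha
        simp [z', Finset.sum_add_distrib, hj, hj', h2]
      · simp [z', ha, h2]
  have hload : ∀ k, ∑ a, z' a k = ∑ a, z a k + ((if k = j' then ε else 0)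
      - (if k = j then ε else 0)) := by
    intro k
    simp [z', Finset.sum_add_distrib]
  have hopt : ∑ k, (∑ a, z a k) ^ 2 / C k ≤ ∑ k, (∑ a, z' a k) ^ 2 / C k := hmin hz'
  -- Since `ε * q ≤ g`, this difference is at most `-ε * g`, which contradicts minimality.
  have hdiff : ∑ k, (∑ a, z' a k) ^ 2 / C k - ∑ k, (∑ a, z a k) ^ 2 / C k =
      ε * (ε * q) - 2 * ε * g := by
    rw [← Finset.sum_sub_distrib, Finset.sum_eq_add j j' hjj.symm]
    · rw [hload, hload]
      have := (hC j).ne'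
      have := (hC j').ne'
      simp only [hjj, hjj.symm, if_true, if_false, q, hg_def]
      field_simp
      ring
    · rintro k - ⟨hk1, hk2⟩
      rw [hload]; simp [hk1, hk2]
    · simp
    · simp
  nlinarith

/-- A transport problem with demands `d` and capacities `C` is solvable if the demand that is
confined to any set of resources does not exceed its capacity. -/
theorem exists_transport {C : κ → ℝ} (hC : ∀ j, 0 < C j) {T : ι → Finset κ}
    (hT : ∀ i, (T i).Nonempty) {d : ι → ℝ} (hd : ∀ i, 0 ≤ d i)
    (h : ∀ R : Finset κ, ∑ i with T i ⊆ R, d i ≤ ∑ j ∈ R, C j) :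
    ∃ z : ι → κ → ℝ, (∀ i j, 0 ≤ z i j) ∧ (∀ i j, j ∉ T i → z i j = 0) ∧
      (∀ i, ∑ j ∈ T i, z i j = d i) ∧ ∀ j, ∑ i, z i j ≤ C j := by
  classical
  obtain ⟨z, h0, h1, h2, h3⟩ := exists_balanced_transport hC hT hd
  refine ⟨z, h0, h1, h2, ?_⟩
  by_contra! hover
  -- In a balanced transport, a user that sends into an overloaded resource can only reach
  -- overloaded ones, so all load on `R` is confined demand and exceeds `C(R)`.
  set R : Finset κ := Finset.univ.filter fun j => C j < ∑ i, z i j with hR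
  have hsub : ∀ i, ∀ j ∈ R, 0 < z i j → T i ⊆ R := by
    intro i j hj hz j' hj'
    have hj2 : C j < ∑ i, z i j := (Finset.mem_filter.1 hj).2
    have := h3 i j j' hz hj'
    refine Finset.mem_filter.2 ⟨Finset.mem_univ _, ?_⟩
    rw [← one_lt_div (hC j)] at hj2
    exact (one_lt_div (hC j')).1 (hj2.trans_le this)
  have h4 : ∑ j ∈ R, C j < ∑ j ∈ R, ∑ i, z i j := by
    obtain ⟨j, hj⟩ := hover
    exact Finset.sum_lt_sum_of_nonempty ⟨j, Finset.mem_filter.2 ⟨Finset.mem_univ _, hj⟩⟩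
      fun j hj => (Finset.mem_filter.1 hj).2
  have h5 : ∑ j ∈ R, ∑ i, z i j = ∑ i with T i ⊆ R, ∑ j ∈ R, z i j := by
    rw [Finset.sum_comm]
    refine (Finset.sum_subset (Finset.filter_subset _ _) fun i _ hi => ?_).symm
    refine Finset.sum_eq_zero fun j hj => ?_
    by_contra hz
    exact hi (Finset.mem_filter.2 ⟨Finset.mem_univ _,
      hsub i j hj (lt_of_le_of_ne (h0 i j) (Ne.symm hz))⟩)
  have h6 : ∑ i with T i ⊆ R, ∑ j ∈ R, z i j = ∑ i with T i ⊆ R, d i := by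
    refine Finset.sum_congr rfl fun i hi => ?_
    rw [← h2 i]
    exact (Finset.sum_subset (Finset.mem_filter.1 hi).2 fun j _ hj => h1 i j hj).symm
  linarith [h R]

end Transport

/-! ### Decomposition into strongly connected sets. -/

namespace Network

variable {ι κ : Type*} [DecidableEq ι] [DecidableEq κ] {N : Network ι κ}

theorem mem_confined {J' : Finset κ} {i : ι} :
    i ∈ N.confined J' ↔ i ∈ N.users ∧ N.routes i ⊆ J' := Finset.mem_filter

theorem confined_mono {A B : Finset κ} (h : A ⊆ B) : N.confined A ⊆ N.confined B :=
  fun _ hi => mem_confined.2 ⟨(mem_confined.1 hi).1, (mem_confined.1 hi).2.trans h⟩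

theorem isStronglyConn_singleton {j : κ} (hj : j ∈ N.resources) : N.IsStronglyConn {j} := by
  refine ⟨Finset.singleton_subset_iff.2 hj, Finset.singleton_nonempty j, ?_⟩
  rintro ⟨J₁, J₂, I₁, I₂, h1, h2, hdis, hun, -⟩
  have h1' : J₁ = {j} := (Finset.Nonempty.subset_singleton_iff h1).1
    (hun ▸ Finset.subset_union_left)
  have h2' : J₂ = {j} := (Finset.Nonempty.subset_singleton_iff h2).1
    (hun ▸ Finset.subset_union_right)
  subst h1' h2'
  simp at hdis

/-- Every nonempty set of resources is built from strongly connected sets by disjoint unions that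
do not confine additional users. -/
theorem strongly_connected_induction (hroutes : ∀ i ∈ N.users, (N.routes i).Nonempty)
    {P : Finset κ → Prop} (strong : ∀ J', N.IsStronglyConn J' → P J')
    (union : ∀ A B, Disjoint A B → Disjoint (N.confined A) (N.confined B) →
      N.confined (A ∪ B) = N.confined A ∪ N.confined B → P A → P B → P (A ∪ B))
    (J' : Finset κ) (hsub : J' ⊆ N.resources) (hne : J'.Nonempty) : P J' := by
  induction J' using Finset.strongInduction with
  | H J' ih =>
    by_cases hs : N.IsStronglyConn J'
    · exact strong J' hs
    · have : ¬ N.ConnectedPair (N.confined J') J' := fun h => hs ⟨hsub, h⟩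
      simp only [ConnectedPair, hne, true_and, not_not] at this
      obtain ⟨J₁, J₂, I₁, I₂, h1, h2, hdis, rfl, hIdis, hI, hI1, hI2⟩ := this
      have hmem : ∀ i ∈ N.confined (J₁ ∪ J₂), i ∈ N.confined J₁ ∨ i ∈ N.confined J₂ := by
        intro i hi
        obtain ⟨hu, hr⟩ := mem_confined.1 hi
        rw [← hI, Finset.mem_union] at hi
        rcases hi with hi | hi
        · refine Or.inl (mem_confined.2 ⟨hu, fun j hj => ?_⟩)
          refine (Finset.mem_union.1 (hr hj)).resolve_right fun hj2 => ?_
          have := hI1 i hi ▸ Finset.mem_inter.2 ⟨hj, hj2⟩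
          simp at this
        · refine Or.inr (mem_confined.2 ⟨hu, fun j hj => ?_⟩)
          refine (Finset.mem_union.1 (hr hj)).resolve_left fun hj2 => ?_
          have := hI2 i hi ▸ Finset.mem_inter.2 ⟨hj, hj2⟩
          simp at this
      have hdisc : Disjoint (N.confined J₁) (N.confined J₂) := by
        refine Finset.disjoint_left.2 fun i hi1 hi2 => ?_
        obtain ⟨j, hj⟩ := hroutes i (mem_confined.1 hi1).1
        exact Finset.disjoint_left.1 hdis ((mem_confined.1 hi1).2 hj) ((mem_confined.1 hi2).2 hj)
      have hunc : N.confined (J₁ ∪ J₂) = N.confined J₁ ∪ N.confined J₂ := by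
        refine Finset.Subset.antisymm (fun i hi => Finset.mem_union.2 (hmem i hi)) ?_
        exact Finset.union_subset (confined_mono Finset.subset_union_left)
          (confined_mono Finset.subset_union_right)
      refine union J₁ J₂ hdis hdisc hunc (ih J₁ ?_ ?_ h1) (ih J₂ ?_ ?_ h2)
      · refine Finset.ssubset_iff_subset_ne.2 ⟨Finset.subset_union_left, fun h => ?_⟩
        obtain ⟨j, hj⟩ := h2
        have : j ∈ J₁ := h ▸ Finset.mem_union_right _ hj
        exact Finset.disjoint_left.1 hdis this hj
      · exact Finset.subset_union_left.trans hsub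
      · refine Finset.ssubset_iff_subset_ne.2 ⟨Finset.subset_union_right, fun h => ?_⟩
        obtain ⟨j, hj⟩ := h1
        have : j ∈ J₂ := h ▸ Finset.mem_union_left _ hj
        exact Finset.disjoint_left.1 hdis hj this
      · exact Finset.subset_union_right.trans hsub

/-- Both sides are additive along the decomposition, so stability need only be assumed for strongly
connected sets. -/
theorem sum_confined_lt (hroutes : ∀ i ∈ N.users, (N.routes i).Nonempty) {g : ι → ℝ} {C : κ → ℝ}
    (h : ∀ J', N.IsStronglyConn J' → ∑ i ∈ N.confined J', g i < ∑ j ∈ J', C j)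
    (J' : Finset κ) (hsub : J' ⊆ N.resources) (hne : J'.Nonempty) :
    ∑ i ∈ N.confined J', g i < ∑ j ∈ J', C j := by
  refine strongly_connected_induction hroutes (P := fun J' =>
    ∑ i ∈ N.confined J', g i < ∑ j ∈ J', C j) h (fun A B hd hc hun hA hB => ?_) J' hsub hne
  rw [hun, Finset.sum_union hc, Finset.sum_union hd]
  exact add_lt_add hA hB

end Network

/-! ### Uniqueness of the equilibrium rates. -/

section Uniqueness

variable {ι κ : Type*} [Fintype ι] [Fintype κ] [DecidableEq ι] [DecidableEq κ]
  {C : κ → ℝ} {S : ι → Finset κ} {n x : ι → ℝ} {y : ι → κ → ℝ}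

theorem IsFeasible.sum_users_eq (h : IsFeasible C S n x y) {A : Finset ι} {B : Finset κ}
    (hAB : ∀ i ∈ A, ∀ j, 0 < y i j → j ∈ B) :
    ∑ i ∈ A, n i * x i = ∑ j ∈ B, ∑ i ∈ A, n i * y i j := by
  rw [Finset.sum_comm]
  refine Finset.sum_congr rfl fun i hi => ?_
  rw [← h.sum_rate i, Finset.mul_sum]
  refine (Finset.sum_subset (Finset.subset_univ _) fun j _ hj => ?_).symm
  have : y i j = 0 := le_antisymm (le_of_not_gt fun hy => hj (hAB i hi j hy)) (h.nonneg i j)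
  rw [this, mul_zero]

theorem IsFeasible.sum_users_eq_load (h : IsFeasible C S n x y) {A : Finset ι} {B : Finset κ}
    (hAB : ∀ i ∈ A, ∀ j, 0 < y i j → j ∈ B) (hBA : ∀ j ∈ B, ∀ i, 0 < y i j → i ∈ A) :
    ∑ i ∈ A, n i * x i = ∑ j ∈ B, ∑ i, n i * y i j := by
  rw [h.sum_users_eq hAB]
  refine Finset.sum_congr rfl fun j hj => ?_
  refine Finset.sum_subset (Finset.subset_univ _) fun i _ hi => ?_
  have : y i j = 0 := le_antisymm (le_of_not_gt fun hy => hi (hBA j hj i hy)) (h.nonneg i j)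
  rw [this, mul_zero]

theorem IsFeasible.sum_users_le_load (h : IsFeasible C S n x y) (hn : ∀ i, 0 < n i)
    (A : Finset ι) (j : κ) : ∑ i ∈ A, n i * y i j ≤ ∑ i, n i * y i j :=
  Finset.sum_le_sum_of_subset_of_nonneg (Finset.subset_univ _)
    fun i _ _ => mul_nonneg (hn i).le (h.nonneg i j)

theorem IsFeasible.sum_users_le (h : IsFeasible C S n x y) (hn : ∀ i, 0 < n i)
    {A : Finset ι} {B : Finset κ} (hAB : ∀ i ∈ A, ∀ j, 0 < y i j → j ∈ B) :
    ∑ i ∈ A, n i * x i ≤ ∑ j ∈ B, C j := by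
  rw [h.sum_users_eq hAB]
  exact Finset.sum_le_sum fun j _ => (h.sum_users_le_load hn A j).trans (h.capacity j)

/-- When `A` alone exhausts the capacity of `B`, there is no room for anybody else. -/
theorem IsFeasible.mem_users_of_eq (h : IsFeasible C S n x y) (hn : ∀ i, 0 < n i)
    {A : Finset ι} {B : Finset κ} (hAB : ∀ i ∈ A, ∀ j, 0 < y i j → j ∈ B)
    (heq : ∑ i ∈ A, n i * x i = ∑ j ∈ B, C j) {i : ι} {j : κ} (hj : j ∈ B) (hy : 0 < y i j) :
    i ∈ A := by
  by_contra hi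
  rw [h.sum_users_eq hAB, Finset.sum_eq_sum_iff_of_le fun j _ =>
    (h.sum_users_le_load hn A j).trans (h.capacity j)] at heq
  have h1 := h.sum_users_le_load hn (insert i A) j
  rw [Finset.sum_insert hi, heq j hj] at h1
  linarith [h.capacity j, mul_pos (hn i) hy]

namespace IsFairAllocation

/-- A set of saturated resources whose users bring in exactly the traffic `ρ` contradicts the
nondegeneracy condition. -/
theorem not_critical (h : IsFairAllocation C S n x y) {ρ : ι → ℝ}
    (hbal : ∀ J', (fullNetwork S).IsConn J' → ∀ I' : Finset ι, (fullNetwork S).confined J' ⊆ I' →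
      I' ⊆ (fullNetwork S).touching J' → ∑ i ∈ I', ρ i ≠ ∑ j ∈ J', C j)
    (A : Finset κ) (hne : A.Nonempty) (hsat : ∀ j ∈ A, ∑ i, n i * y i j = C j)
    (husers : ∀ j ∈ A, ∀ i, 0 < y i j → (∀ j', 0 < y i j' → j' ∈ A) ∧ n i * x i = ρ i) :
    False := by
  induction A using Finset.strongInduction with
  | H A ih =>
    by_cases hc : (fullNetwork S).IsConn A
    · set I' : Finset ι := Finset.univ.filter fun i => ∃ j ∈ A, 0 < y i j with hI'
      have hmem : ∀ i, i ∈ I' ↔ ∃ j ∈ A, 0 < y i j := fun i => by simp [hI']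
      refine hbal A hc I' (fun i hi => ?_) (fun i hi => ?_) ?_
      · obtain ⟨j, hj, hy⟩ := h.exists_resource i
        exact (hmem i).2 ⟨j, (Network.mem_confined.1 hi).2 hj, hy⟩
      · obtain ⟨j, hj, hy⟩ := (hmem i).1 hi
        exact Finset.mem_filter.2 ⟨Finset.mem_univ i,
          j, Finset.mem_inter.2 ⟨h.mem_of_pos hy, hj⟩⟩
      · rw [← Finset.sum_congr rfl hsat, ← h.feasible.sum_users_eq_load (A := I')]
        · refine Finset.sum_congr rfl fun i hi => ?_
          obtain ⟨j, hj, hy⟩ := (hmem i).1 hi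
          exact (husers j hj i hy).2.symm
        · intro i hi
          obtain ⟨j, hj, hy⟩ := (hmem i).1 hi
          exact (husers j hj i hy).1
        · exact fun j hj i hy => (hmem i).2 ⟨j, hj, hy⟩
    · have : ¬ (fullNetwork S).ConnectedPair (fullNetwork S).users A :=
        fun h => hc ⟨Finset.subset_univ _, h⟩
      simp only [Network.ConnectedPair, hne, true_and, not_not] at this
      obtain ⟨J₁, J₂, I₁, I₂, h1, h2, hdis, rfl, -, hI, hI1, hI2⟩ := this
      -- No user can use both halves, so the smaller set `J₁` inherits all hypotheses.
      refine ih J₁ ?_ h1 (fun j hj => hsat j (Finset.mem_union_left _ hj)) fun j hj i hy => ?_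
      · refine Finset.ssubset_iff_subset_ne.2 ⟨Finset.subset_union_left, fun h => ?_⟩
        obtain ⟨j, hj⟩ := h2
        have : j ∈ J₁ := h ▸ Finset.mem_union_right _ hj
        exact Finset.disjoint_left.1 hdis this hj
      · obtain ⟨h3, h4⟩ := husers j (Finset.mem_union_left _ hj) i hy
        refine ⟨fun j' hy' => ?_, h4⟩
        refine (Finset.mem_union.1 (h3 j' hy')).resolve_right fun hj2 => ?_
        have hi : i ∈ I₁ ∪ I₂ := hI ▸ Finset.mem_univ i
        rcases Finset.mem_union.1 hi with hi | hi
        · have := hI1 i hi ▸ Finset.mem_inter.2 ⟨h.mem_of_pos hy', hj2⟩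
          simp at this
        · have := hI2 i hi ▸ Finset.mem_inter.2 ⟨h.mem_of_pos hy, hj⟩
          simp at this

end IsFairAllocation

/-- The capacity that users of type `i` consume at equilibrium if their rate is `v`. -/
noncomputable def peakLoad (ρ r : ι → ℝ) (i : ι) (v : ℝ) : ℝ := max (ρ i) (ρ i / r i * v)

section PeakLoad

variable {ρ r : ι → ℝ}

theorem peakLoad_mono (hρ : ∀ i, 0 < ρ i) (hr : ∀ i, 0 < r i) (i : ι) :
    Monotone (peakLoad ρ r i) := fun _ _ h =>
  max_le_max le_rfl (mul_le_mul_of_nonneg_left h (div_pos (hρ i) (hr i)).le)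

/-- The equilibrium equation eliminates the number of flows: aggregate traffic becomes a function of
the rate. -/
theorem mul_rate_eq_peakLoad {n x ρ r : ℝ} (hρ : 0 < ρ) (hr : 0 < r)
    (h : n * min x r = ρ) : n * x = max ρ (ρ / r * x) := by
  rcases le_total x r with hxr | hxr
  · rw [min_eq_left hxr] at h
    rw [h, max_eq_left]
    rw [div_mul_eq_mul_div, div_le_iff₀ hr]
    exact mul_le_mul_of_nonneg_left hxr hρ.le
  · rw [min_eq_right hxr] at h
    rw [max_eq_right, ← h, mul_div_cancel_right₀ _ hr.ne']
    rw [div_mul_eq_mul_div, le_div_iff₀ hr]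
    exact mul_le_mul_of_nonneg_left hxr hρ.le

/-- The load is constant up to the peak rate and strictly increasing beyond it. -/
theorem peakLoad_eq_of_eq (hρ : ∀ i, 0 < ρ i) (hr : ∀ i, 0 < r i) {i : ι} {u v : ℝ} (huv : u < v)
    (h : peakLoad ρ r i u = peakLoad ρ r i v) : peakLoad ρ r i v = ρ i := by
  unfold peakLoad at *
  by_contra hne
  have hlt : ρ i < ρ i / r i * v := by
    by_contra! hle
    exact hne (max_eq_left hle)
  rw [max_eq_right hlt.le] at h
  have : ρ i / r i * u < ρ i / r i * v := mul_lt_mul_of_pos_left huv (div_pos (hρ i) (hr i))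
  exact (max_lt hlt this).ne h

end PeakLoad

namespace IsFairAllocation

variable {n' x' : ι → ℝ} {y' : ι → κ → ℝ} {ρ r : ι → ℝ}

/-- Two equilibria cannot differ at the smallest rate at which they could. -/
theorem false_of_lt (h : IsFairAllocation C S n x y) (h' : IsFairAllocation C S n' x' y')
    (hC : ∀ j, 0 < C j) (hn' : ∀ i, 0 < n' i)
    (hρ : ∀ i, 0 < ρ i) (hr : ∀ i, 0 < r i)
    (heq : ∀ i, n i * x i = peakLoad ρ r i (x i)) (heq' : ∀ i, n' i * x' i = peakLoad ρ r i (x' i))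
    (hbal : ∀ J', (fullNetwork S).IsConn J' → ∀ I' : Finset ι, (fullNetwork S).confined J' ⊆ I' →
      I' ⊆ (fullNetwork S).touching J' → ∑ i ∈ I', ρ i ≠ ∑ j ∈ J', C j)
    {a : ι} (ha : x a < x' a) (hmin : ∀ i, x i ≠ x' i → x a ≤ x' i) : False := by
  set I₀ : Finset ι := Finset.univ.filter fun i => x i ≤ x a with hI₀
  set J₀ : Finset κ := Finset.univ.filter fun j => ∃ i, 0 < y i j ∧ x i ≤ x a with hJ₀
  have memI : ∀ i, i ∈ I₀ ↔ x i ≤ x a := fun i => by simp [hI₀]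
  have memJ : ∀ j, j ∈ J₀ ↔ ∃ i, 0 < y i j ∧ x i ≤ x a := fun j => by simp [hJ₀]
  have hsub : ∀ i ∈ I₀, S i ⊆ J₀ := by
    intro i hi j hj
    obtain ⟨i', hi'⟩ := h.exists_user hC hj
    exact (memJ j).2 ⟨i', hi', (h.fair i j hj i' hi').trans ((memI i).1 hi)⟩
  have hsat : ∀ j ∈ J₀, ∑ i, n i * y i j = C j := by
    intro j hj
    obtain ⟨i, hi, -⟩ := (memJ j).1 hj
    exact h.saturated i j (h.mem_of_pos hi)
  have hsum : ∑ i ∈ I₀, n i * x i = ∑ j ∈ J₀, C j := by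
    rw [← Finset.sum_congr rfl hsat]
    refine h.feasible.sum_users_eq_load (fun i hi j hy => hsub i hi (h.mem_of_pos hy))
      fun j hj i hy => ?_
    obtain ⟨i', hi', hx'⟩ := (memJ j).1 hj
    exact (memI i).2 ((h.rate_eq hy hi').trans_le hx')
  have hAB : ∀ i ∈ I₀, ∀ j, 0 < y' i j → j ∈ J₀ := fun i hi j hy => hsub i hi (h'.mem_of_pos hy)
  have hle : ∀ i ∈ I₀, x i ≤ x' i := by
    intro i hi
    by_cases hxi : x i = x' i
    · exact hxi.le
    · exact ((memI i).1 hi).trans (hmin i hxi)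
  have hterm : ∀ i ∈ I₀, n i * x i ≤ n' i * x' i := fun i hi => by
    rw [heq, heq']; exact peakLoad_mono hρ hr i (hle i hi)
  -- The loads of `I₀` are no smaller in the second equilibrium, yet `J₀` was already full in the
  -- first and still confines `I₀`. Hence the loads agree one by one.
  have hsum' : ∑ i ∈ I₀, n' i * x' i = ∑ j ∈ J₀, C j :=
    le_antisymm (h'.feasible.sum_users_le hn' hAB) (hsum ▸ Finset.sum_le_sum hterm)
  have hload : ∀ i ∈ I₀, n i * x i = n' i * x' i :=
    (Finset.sum_eq_sum_iff_of_le hterm).1 (hsum.trans hsum'.symm)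
  have hback : ∀ j ∈ J₀, ∀ i, 0 < y' i j → i ∈ I₀ := fun j hj i hy =>
    h'.feasible.mem_users_of_eq hn' hAB hsum' hj hy
  -- The users of `A` in the second equilibrium have strictly larger rates than in the first but
  -- equal loads, so their loads are `ρ`.
  set A : Finset κ := J₀.filter fun j => ∃ i, 0 < y' i j ∧ x a < x' i with hA
  have haI : a ∈ I₀ := (memI a).2 le_rfl
  refine h'.not_critical hbal A ?_ (fun j hj => ?_) fun j hj i hy => ?_
  · obtain ⟨j, hj, hy⟩ := h'.exists_resource a
    exact ⟨j, Finset.mem_filter.2 ⟨hAB a haI j hy, a, hy, ha⟩⟩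
  · obtain ⟨-, i, hi, -⟩ := Finset.mem_filter.1 hj
    exact h'.saturated i j (h'.mem_of_pos hi)
  · obtain ⟨hj, i', hi', hx'⟩ := Finset.mem_filter.1 hj
    have hxi : x a < x' i := h'.rate_eq hi' hy ▸ hx'
    have hi := hback j hj i hy
    refine ⟨fun j' hy' => Finset.mem_filter.2 ⟨hAB i hi j' hy', i, hy', hxi⟩, ?_⟩
    rw [heq']
    refine peakLoad_eq_of_eq hρ hr (((memI i).1 hi).trans_lt hxi) ?_
    rw [← heq, ← heq', hload i hi]

/-- Choose a user at which the rates differ and the smaller of the two is least; by symmetry either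
equilibrium may be the one with the smaller rate. -/
theorem equilibrium_rate_unique (h : IsFairAllocation C S n x y)
    (h' : IsFairAllocation C S n' x' y')
    (hC : ∀ j, 0 < C j) (hn : ∀ i, 0 < n i) (hn' : ∀ i, 0 < n' i)
    (hρ : ∀ i, 0 < ρ i) (hr : ∀ i, 0 < r i)
    (heq : ∀ i, n i * x i = peakLoad ρ r i (x i)) (heq' : ∀ i, n' i * x' i = peakLoad ρ r i (x' i))
    (hbal : ∀ J', (fullNetwork S).IsConn J' → ∀ I' : Finset ι, (fullNetwork S).confined J' ⊆ I' →
      I' ⊆ (fullNetwork S).touching J' → ∑ i ∈ I', ρ i ≠ ∑ j ∈ J', C j) : x = x' := by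
  by_contra hne
  obtain ⟨i₀, hi₀⟩ := Function.ne_iff.1 hne
  obtain ⟨a, ha, hmin⟩ := Finset.exists_min_image (Finset.univ.filter fun i => x i ≠ x' i)
    (fun i => min (x i) (x' i)) ⟨i₀, Finset.mem_filter.2 ⟨Finset.mem_univ _, hi₀⟩⟩
  have hmin' : ∀ i, x i ≠ x' i → min (x a) (x' a) ≤ min (x i) (x' i) := fun i hi =>
    hmin i (Finset.mem_filter.2 ⟨Finset.mem_univ _, hi⟩)
  rcases lt_or_gt_of_ne (Finset.mem_filter.1 ha).2 with hlt | hlt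
  · rw [min_eq_left hlt.le] at hmin'
    exact h.false_of_lt h' hC hn' hρ hr heq heq' hbal hlt
      fun i hi => (hmin' i hi).trans (min_le_right _ _)
  · rw [min_eq_right hlt.le] at hmin'
    exact h'.false_of_lt h hC hn hρ hr heq' heq hbal hlt
      fun i hi => (hmin' i hi.symm).trans (min_le_left _ _)

end IsFairAllocation

end Uniqueness

/-! ### The fractions of the algorithm in terms of `peakLoad`. -/

section Ratio

variable {m : ℕ} {κ : Type*} [Fintype κ] [DecidableEq κ]
  {C : κ → ℝ} {ρ r : Fin m → ℝ} {N : Network (Fin m) κ}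

/-- The threshold `s` is the last index whose peak rate is at most `v`. The lower bound on `v` is
needed because no index in `Fin m` encodes an empty set of constrained types. -/
theorem exists_peakLoad_eq (hm : 0 < m) (hρ : ∀ i, 0 < ρ i) (hr : ∀ i, 0 < r i)
    (hr_mono : Monotone r) {v : ℝ} (hv : r ⟨0, hm⟩ ≤ v) :
    ∃ s : Fin m, ∀ i, peakLoad ρ r i v = if i ≤ s then ρ i / r i * v else ρ i := by
  obtain ⟨s, hs, hmax⟩ := Finset.exists_max_image (Finset.univ.filter fun i => r i ≤ v) id
    ⟨⟨0, hm⟩, Finset.mem_filter.2 ⟨Finset.mem_univ _, hv⟩⟩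
  refine ⟨s, fun i => ?_⟩
  split_ifs with hi
  · refine max_eq_right ?_
    rw [div_mul_eq_mul_div, le_div_iff₀ (hr i)]
    exact mul_le_mul_of_nonneg_left ((hr_mono hi).trans (Finset.mem_filter.1 hs).2) (hρ i).le
  · refine max_eq_left ?_
    rw [div_mul_eq_mul_div, div_le_iff₀ (hr i)]
    refine mul_le_mul_of_nonneg_left (le_of_not_ge fun h => hi ?_) (hρ i).le
    exact hmax i (Finset.mem_filter.2 ⟨Finset.mem_univ _, h⟩)

theorem sum_partial_eq (N : Network (Fin m) κ) (J' : Finset κ) (s : Fin m) (v : ℝ) :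
    ∑ i ∈ N.confined J', (if i ≤ s then ρ i / r i * v else ρ i) =
      (∑ i ∈ (N.confined J').filter (fun i => i ≤ s), ρ i / r i) * v +
        ∑ i ∈ (N.confined J').filter (fun i => s < i), ρ i := by
  rw [Finset.sum_ite, Finset.sum_mul]
  simp only [not_le]

theorem partial_le_peakLoad (s i : Fin m) (v : ℝ) :
    (if i ≤ s then ρ i / r i * v else ρ i) ≤ peakLoad ρ r i v := by
  split_ifs
  · exact le_max_right _ _
  · exact le_max_left _ _

section Single

variable {J' : Finset κ} (hρ : ∀ i, 0 < ρ i) (hr : ∀ i, 0 < r i)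
  (hst : ∑ i ∈ N.confined J', ρ i < ∑ j ∈ J', C j)
include hρ hr hst

theorem peakRatio_numerator_pos (s : Fin m) :
    0 < ∑ j ∈ J', C j - ∑ i ∈ (N.confined J').filter (fun i => s < i), ρ i := by
  have := Finset.sum_le_sum_of_subset_of_nonneg
    (Finset.filter_subset (fun i => s < i) (N.confined J')) fun i _ _ => (hρ i).le
  linarith

theorem le_peakRatio_iff (s : Fin m) (v : ℝ) :
    (v : EReal) ≤ peakRatio C ρ r N J' s ↔
      ∑ i ∈ N.confined J', (if i ≤ s then ρ i / r i * v else ρ i) ≤ ∑ j ∈ J', C j := by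
  have hnum := peakRatio_numerator_pos hρ hr hst s
  rw [sum_partial_eq]
  have hden : 0 ≤ ∑ i ∈ (N.confined J').filter (fun i => i ≤ s), ρ i / r i :=
    Finset.sum_nonneg fun i _ => (div_pos (hρ i) (hr i)).le
  unfold peakRatio
  dsimp only
  split_ifs with h0
  · rw [h0, zero_mul]
    refine iff_of_true le_top (by linarith)
  · rw [EReal.coe_le_coe_iff, le_div_iff₀ (lt_of_le_of_ne hden (Ne.symm h0))]
    constructor <;> intro h <;> linarith

theorem peakRatio_eq_iff (s : Fin m) (v : ℝ) :
    peakRatio C ρ r N J' s = (v : EReal) ↔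
      ∑ i ∈ N.confined J', (if i ≤ s then ρ i / r i * v else ρ i) = ∑ j ∈ J', C j := by
  have hnum := peakRatio_numerator_pos hρ hr hst s
  rw [sum_partial_eq]
  unfold peakRatio
  dsimp only
  split_ifs with h0
  · rw [h0, zero_mul]
    refine iff_of_false (EReal.coe_ne_top v).symm (by linarith)
  · rw [EReal.coe_eq_coe_iff, div_eq_iff h0]
    constructor <;> intro h <;> linarith

/-- Every threshold gives a lower bound for the load and the right one gives the load itself, so
quantifying over thresholds reproduces the maximum in `peakLoad`. -/
theorem forall_le_peakRatio_iff (hm : 0 < m) (hr_mono : Monotone r) {v : ℝ}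
    (hv : r ⟨0, hm⟩ ≤ v) :
    (∀ s, (v : EReal) ≤ peakRatio C ρ r N J' s) ↔
      ∑ i ∈ N.confined J', peakLoad ρ r i v ≤ ∑ j ∈ J', C j := by
  constructor
  · intro h
    obtain ⟨s, hs⟩ := exists_peakLoad_eq hm hρ hr hr_mono hv
    simp only [hs]
    exact (le_peakRatio_iff hρ hr hst s v).1 (h s)
  · intro h s
    exact (le_peakRatio_iff hρ hr hst s v).2
      ((Finset.sum_le_sum fun i _ => partial_le_peakLoad s i v).trans h)

theorem exists_peakRatio_eq_iff (hm : 0 < m) (hr_mono : Monotone r) {v : ℝ}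
    (hv : r ⟨0, hm⟩ ≤ v) (hle : ∑ i ∈ N.confined J', peakLoad ρ r i v ≤ ∑ j ∈ J', C j) :
    (∃ s, peakRatio C ρ r N J' s = (v : EReal)) ↔
      ∑ i ∈ N.confined J', peakLoad ρ r i v = ∑ j ∈ J', C j := by
  constructor
  · rintro ⟨s, hs⟩
    rw [peakRatio_eq_iff hρ hr hst] at hs
    exact le_antisymm hle (hs ▸ Finset.sum_le_sum fun i _ => partial_le_peakLoad s i v)
  · intro h
    obtain ⟨s, hs⟩ := exists_peakLoad_eq hm hρ hr hr_mono hv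
    refine ⟨s, (peakRatio_eq_iff hρ hr hst s v).2 ?_⟩
    simp only [← hs]
    exact h

/-- At the first peak rate all loads still equal `ρ`, so stability leaves strict slack. -/
theorem first_peak_lt_peakRatio (hm : 0 < m) (hr_mono : Monotone r) (s : Fin m) :
    (r ⟨0, hm⟩ : EReal) < peakRatio C ρ r N J' s := by
  have h0 : ∀ i, peakLoad ρ r i (r ⟨0, hm⟩) = ρ i := fun i => by
    refine max_eq_left ?_
    rw [div_mul_eq_mul_div, div_le_iff₀ (hr i)]
    exact mul_le_mul_of_nonneg_left (hr_mono (Nat.zero_le i.1)) (hρ i).le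
  have hle : ∑ i ∈ N.confined J', peakLoad ρ r i (r ⟨0, hm⟩) ≤ ∑ j ∈ J', C j := by
    simp only [h0]; exact hst.le
  refine lt_of_le_of_ne ((forall_le_peakRatio_iff hρ hr hst hm hr_mono le_rfl).2 hle s) ?_
  intro heq
  have := (exists_peakRatio_eq_iff hρ hr hst hm hr_mono le_rfl hle).1 ⟨s, heq.symm⟩
  simp only [h0] at this
  exact hst.ne this

end Single

end Ratio

/-! ### One step of the algorithm: tight sets and their removal. -/

namespace Network

section Remove

variable {ι κ : Type*} [DecidableEq ι] [DecidableEq κ] {N : Network ι κ}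

theorem confined_remove (J₀ J' : Finset κ) :
    (N.remove J₀).confined J' = N.confined (J₀ ∪ J') \ N.confined J₀ := by
  ext i
  simp only [Finset.mem_sdiff, mem_confined, remove]
  have : N.routes i \ J₀ ⊆ J' ↔ N.routes i ⊆ J₀ ∪ J' := sdiff_le_iff
  rw [this]
  tauto

/-- Users can reach some resource, all resources they can reach are present, and every set of
resources is stable. -/
structure Admissible (N : Network ι κ) (C : κ → ℝ) (ρ : ι → ℝ) : Prop where
  routes_nonempty : ∀ i ∈ N.users, (N.routes i).Nonempty
  routes_subset : ∀ i ∈ N.users, N.routes i ⊆ N.resources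
  stable : ∀ J' ⊆ N.resources, J'.Nonempty → ∑ i ∈ N.confined J', ρ i < ∑ j ∈ J', C j

theorem Admissible.confined_resources {C : κ → ℝ} {ρ : ι → ℝ} (h : N.Admissible C ρ) :
    N.confined N.resources = N.users :=
  Finset.filter_true_of_mem h.routes_subset

theorem Admissible.confined_empty {C : κ → ℝ} {ρ : ι → ℝ} (h : N.Admissible C ρ) :
    N.confined ∅ = ∅ := Finset.eq_empty_of_forall_notMem fun i hi => by
  obtain ⟨hu, hs⟩ := mem_confined.1 hi
  exact (h.routes_nonempty i hu).ne_empty (Finset.subset_empty.1 hs)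

theorem Exhausted.admissible (h : N.Exhausted) (C : κ → ℝ) (ρ : ι → ℝ) : N.Admissible C ρ := by
  refine ⟨fun i hi => ?_, fun i hi => ?_, fun J' hJ hne => ?_⟩
  · rw [h.1] at hi; simp at hi
  · rw [h.1] at hi; simp at hi
  · rw [h.2] at hJ
    exact absurd (Finset.subset_empty.1 hJ) hne.ne_empty

theorem Admissible.resources_nonempty {C : κ → ℝ} {ρ : ι → ℝ} (h : N.Admissible C ρ)
    (hex : ¬ N.Exhausted) : N.resources.Nonempty := by
  by_contra hne
  rw [Finset.not_nonempty_iff_eq_empty] at hne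
  refine hex ⟨Finset.eq_empty_of_forall_notMem fun i hi => ?_, hne⟩
  have h1 := h.routes_nonempty i hi
  have h2 := h.routes_subset i hi
  rw [hne, Finset.subset_empty] at h2
  exact h1.ne_empty h2

end Remove

section Step

variable {m : ℕ} {κ : Type*} [Fintype κ] [DecidableEq κ]
  {C : κ → ℝ} {ρ r : Fin m → ℝ} {N : Network (Fin m) κ}

theorem mem_strongSets {J' : Finset κ} : J' ∈ N.strongSets ↔ N.IsStronglyConn J' := by
  simp only [strongSets, Finset.mem_filter, Finset.mem_powerset, and_iff_right_iff_imp]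
  exact fun h => h.1

theorem minRatio_le {J' : Finset κ} (hJ : N.IsStronglyConn J') (s : Fin m) :
    minRatio C ρ r N ≤ peakRatio C ρ r N J' s :=
  Finset.inf_le (f := fun p : Finset κ × Fin m => peakRatio C ρ r N p.1 p.2) (b := (J', s))
    (Finset.mem_product.2 ⟨mem_strongSets.2 hJ, Finset.mem_univ _⟩)

theorem exists_minRatio_eq (hm : 0 < m) (hne : N.resources.Nonempty) :
    ∃ J', N.IsStronglyConn J' ∧ ∃ s, peakRatio C ρ r N J' s = minRatio C ρ r N := by
  obtain ⟨j, hj⟩ := hne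
  obtain ⟨p, hp, hpe⟩ := Finset.exists_mem_eq_inf
    (N.strongSets ×ˢ (Finset.univ : Finset (Fin m)))
    ⟨({j}, ⟨0, hm⟩), Finset.mem_product.2 ⟨mem_strongSets.2 (isStronglyConn_singleton hj),
      Finset.mem_univ _⟩⟩ (fun p => peakRatio C ρ r N p.1 p.2)
  exact ⟨p.1, mem_strongSets.1 (Finset.mem_product.1 hp).1, p.2, hpe.symm⟩

theorem mem_minimizers {j : κ} : j ∈ minimizers C ρ r N ↔ ∃ J', N.IsStronglyConn J' ∧
    (∃ s, peakRatio C ρ r N J' s = minRatio C ρ r N) ∧ j ∈ J' := by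
  simp only [minimizers, Finset.mem_biUnion, Finset.mem_filter, mem_strongSets, and_assoc]

theorem minimizers_subset : minimizers C ρ r N ⊆ N.resources := fun j hj => by
  obtain ⟨J', hJ, -, hj⟩ := mem_minimizers.1 hj
  exact hJ.1 hj

theorem minimizers_nonempty (hm : 0 < m) (hne : N.resources.Nonempty) :
    (minimizers C ρ r N).Nonempty := by
  obtain ⟨J', hJ, hs⟩ := exists_minRatio_eq (C := C) (ρ := ρ) (r := r) hm hne
  obtain ⟨j, hj⟩ := hJ.2.1
  exact ⟨j, mem_minimizers.2 ⟨J', hJ, hs, hj⟩⟩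

namespace Admissible

variable (h : N.Admissible C ρ) (hm : 0 < m) (hρ : ∀ i, 0 < ρ i) (hr : ∀ i, 0 < r i)
  (hr_mono : Monotone r)
include h hm hρ hr hr_mono

theorem first_peak_lt_minRatio : (r ⟨0, hm⟩ : EReal) < minRatio C ρ r N := by
  refine (Finset.lt_inf_iff (EReal.coe_lt_top _)).2 fun p hp => ?_
  have hs := mem_strongSets.1 (Finset.mem_product.1 hp).1
  exact first_peak_lt_peakRatio hρ hr (h.stable _ hs.1 hs.2.1) hm hr_mono _

/-- When the minimum is infinite, no users are left and all resources are removed. -/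
theorem users_eq_empty_of_top (htop : minRatio C ρ r N = ⊤) :
    N.users = ∅ ∧ minimizers C ρ r N = N.resources := by
  constructor
  · rcases N.resources.eq_empty_or_nonempty with hres | hres
    · by_contra hne
      exact (h.resources_nonempty fun hex => hne hex.1).ne_empty hres
    · rw [← h.confined_resources]
      refine strongly_connected_induction h.routes_nonempty (P := fun J' => N.confined J' = ∅)
        (fun J' hJ => ?_) (fun A B _ _ hun hA hB => by rw [hun, hA, hB, Finset.union_empty])
        N.resources (Finset.Subset.refl _) hres
      refine Finset.eq_empty_of_forall_notMem fun i hi => ?_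
      -- With threshold `i` the denominator contains the term of `i` itself, so the fraction is
      -- finite.
      have h1 := minRatio_le (C := C) (ρ := ρ) (r := r) hJ i
      rw [htop, top_le_iff] at h1
      have hpos : 0 < ∑ k ∈ (N.confined J').filter (fun k => k ≤ i), ρ k / r k :=
        Finset.sum_pos (fun k _ => div_pos (hρ k) (hr k)) ⟨i, Finset.mem_filter.2 ⟨hi, le_rfl⟩⟩
      unfold peakRatio at h1
      dsimp only at h1
      rw [if_neg hpos.ne'] at h1
      exact EReal.coe_ne_top _ h1
  · refine Finset.Subset.antisymm minimizers_subset fun j hj => ?_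
    have hs := isStronglyConn_singleton hj
    refine mem_minimizers.2 ⟨{j}, hs, ⟨⟨0, hm⟩, ?_⟩, Finset.mem_singleton_self j⟩
    have := minRatio_le (C := C) (ρ := ρ) (r := r) hs ⟨0, hm⟩
    rw [htop, top_le_iff] at this
    rw [this, htop]

section Finite

variable {v : ℝ} (hv : minRatio C ρ r N = v)
include hv

theorem first_peak_le : r ⟨0, hm⟩ ≤ v := by
  have := h.first_peak_lt_minRatio hm hρ hr hr_mono
  rw [hv] at this
  exact (EReal.coe_lt_coe_iff.1 this).le

theorem sum_peakLoad_le {J' : Finset κ} (hJ : J' ⊆ N.resources) :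
    ∑ i ∈ N.confined J', peakLoad ρ r i v ≤ ∑ j ∈ J', C j := by
  have hv0 := h.first_peak_le hm hρ hr hr_mono hv
  rcases J'.eq_empty_or_nonempty with rfl | hne
  · simp [h.confined_empty]
  · refine strongly_connected_induction h.routes_nonempty (P := fun J' =>
      ∑ i ∈ N.confined J', peakLoad ρ r i v ≤ ∑ j ∈ J', C j) (fun J' hs => ?_)
      (fun A B hd hc hun hA hB => ?_) J' hJ hne
    · refine (forall_le_peakRatio_iff hρ hr (h.stable _ hs.1 hs.2.1) hm hr_mono hv0).1 fun s => ?_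
      rw [← hv]
      exact minRatio_le hs s
    · rw [hun, Finset.sum_union hc, Finset.sum_union hd]
      exact add_le_add hA hB

/-- Uncrossing: capacity is modular and confined load is supermodular, while `A ∩ B` and `A ∪ B` are
not overloaded. -/
theorem tight_union {A B : Finset κ} (hA : A ⊆ N.resources) (hB : B ⊆ N.resources)
    (htA : ∑ i ∈ N.confined A, peakLoad ρ r i v = ∑ j ∈ A, C j)
    (htB : ∑ i ∈ N.confined B, peakLoad ρ r i v = ∑ j ∈ B, C j) :
    ∑ i ∈ N.confined (A ∪ B), peakLoad ρ r i v = ∑ j ∈ A ∪ B, C j := by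
  have hle := fun J' hJ => h.sum_peakLoad_le (J' := J') hm hρ hr hr_mono hv hJ
  refine le_antisymm (hle _ (Finset.union_subset hA hB)) ?_
  have h1 := hle _ (Finset.inter_subset_left.trans hA : A ∩ B ⊆ N.resources)
  have h2 : N.confined A ∪ N.confined B ⊆ N.confined (A ∪ B) :=
    Finset.union_subset (confined_mono Finset.subset_union_left)
      (confined_mono Finset.subset_union_right)
  have h3 : N.confined A ∩ N.confined B = N.confined (A ∩ B) := by
    ext i
    simp only [Finset.mem_inter, mem_confined, Finset.subset_inter_iff]
    tauto
  have h4 := Finset.sum_le_sum_of_subset_of_nonneg (f := fun i => peakLoad ρ r i v) h2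
    fun i _ _ => (hρ i).le.trans (le_max_left _ _)
  have h5 := Finset.sum_union_inter (s₁ := N.confined A) (s₂ := N.confined B)
    (f := fun i => peakLoad ρ r i v)
  have h6 := Finset.sum_union_inter (s₁ := A) (s₂ := B) (f := C)
  rw [h3] at h5
  linarith

theorem tight_minimizers :
    ∑ i ∈ N.confined (minimizers C ρ r N), peakLoad ρ r i v = ∑ j ∈ minimizers C ρ r N, C j := by
  classical
  have hv0 := h.first_peak_le hm hρ hr hr_mono hv
  set F := N.strongSets.filter fun J' => ∃ s, peakRatio C ρ r N J' s = minRatio C ρ r N with hF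
  have hmin : minimizers C ρ r N = F.biUnion fun J' => J' := by
    ext j
    simp only [mem_minimizers, hF, Finset.mem_biUnion, Finset.mem_filter, mem_strongSets, and_assoc]
  rw [hmin]
  have hFs : ∀ J' ∈ F, N.IsStronglyConn J' ∧ ∃ s, peakRatio C ρ r N J' s = minRatio C ρ r N := by
    intro J' hJ
    rw [hF, Finset.mem_filter, mem_strongSets] at hJ
    exact hJ
  -- Only membership facts about `F` are kept, so that the induction runs over arbitrary families of
  -- minimising sets.
  clear_value F
  clear hF hmin
  suffices (F.biUnion fun J' => J') ⊆ N.resources ∧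
      ∑ i ∈ N.confined (F.biUnion fun J' => J'), peakLoad ρ r i v =
        ∑ j ∈ F.biUnion fun J' => J', C j from this.2
  induction F using Finset.induction_on with
  | empty => simp [h.confined_empty]
  | insert A F _ ih =>
    obtain ⟨ih1, ih2⟩ := ih fun J' hJ => hFs J' (Finset.mem_insert_of_mem hJ)
    obtain ⟨hs, hA⟩ := hFs A (Finset.mem_insert_self _ _)
    rw [Finset.biUnion_insert]
    refine ⟨Finset.union_subset hs.1 ih1, h.tight_union hm hρ hr hr_mono hv hs.1 ih1 ?_ ih2⟩
    rw [hv] at hA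
    exact (exists_peakRatio_eq_iff hρ hr (h.stable _ hs.1 hs.2.1) hm hr_mono hv0
      (h.sum_peakLoad_le hm hρ hr hr_mono hv hs.1)).1 hA

/-- In a tight disjoint union of sets that are not overloaded both parts are tight. The induction
therefore carries the inequality along and descends to strongly connected tight sets, which are
minimisers. -/
theorem subset_minimizers_of_tight {J' : Finset κ} (hJ : J' ⊆ N.resources)
    (ht : ∑ i ∈ N.confined J', peakLoad ρ r i v = ∑ j ∈ J', C j) : J' ⊆ minimizers C ρ r N := by
  have hv0 := h.first_peak_le hm hρ hr hr_mono hv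
  rcases J'.eq_empty_or_nonempty with rfl | hne
  · exact Finset.empty_subset _
  revert ht
  refine (strongly_connected_induction h.routes_nonempty (P := fun J' =>
    ∑ i ∈ N.confined J', peakLoad ρ r i v ≤ ∑ j ∈ J', C j ∧
      (∑ i ∈ N.confined J', peakLoad ρ r i v = ∑ j ∈ J', C j → J' ⊆ minimizers C ρ r N))
      (fun J' hs => ?_) (fun A B hd hc hun hA hB => ?_) J' hJ hne).2
  · have hle := h.sum_peakLoad_le hm hρ hr hr_mono hv hs.1
    refine ⟨hle, fun ht j hj => mem_minimizers.2 ⟨J', hs, ?_, hj⟩⟩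
    rw [hv]
    exact (exists_peakRatio_eq_iff hρ hr (h.stable _ hs.1 hs.2.1) hm hr_mono hv0 hle).2 ht
  · rw [hun, Finset.sum_union hc, Finset.sum_union hd]
    refine ⟨add_le_add hA.1 hB.1, fun ht => ?_⟩
    exact Finset.union_subset (hA.2 (by linarith [hA.1, hB.1])) (hB.2 (by linarith [hA.1, hB.1]))

/-- After the removal of the minimising sets the rate can be increased strictly. -/
theorem sum_peakLoad_remove_lt {J' : Finset κ} (hJ : J' ⊆ (N.remove (minimizers C ρ r N)).resources)
    (hne : J'.Nonempty) :
    ∑ i ∈ (N.remove (minimizers C ρ r N)).confined J', peakLoad ρ r i v < ∑ j ∈ J', C j := by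
  set M := minimizers C ρ r N with hM
  have hJ' : J' ⊆ N.resources \ M := hJ
  have hsub : M ∪ J' ⊆ N.resources :=
    Finset.union_subset minimizers_subset (hJ'.trans Finset.sdiff_subset)
  have hdis : Disjoint M J' := Finset.disjoint_right.2 fun j hj => (Finset.mem_sdiff.1 (hJ' hj)).2
  have h1 : ∑ i ∈ N.confined (M ∪ J'), peakLoad ρ r i v < ∑ j ∈ M ∪ J', C j := by
    refine lt_of_le_of_ne (h.sum_peakLoad_le hm hρ hr hr_mono hv hsub) fun ht => ?_
    have := h.subset_minimizers_of_tight hm hρ hr hr_mono hv hsub ht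
    obtain ⟨j, hj⟩ := hne
    exact Finset.disjoint_right.1 hdis hj (this (Finset.mem_union_right _ hj))
  have h2 := h.tight_minimizers hm hρ hr hr_mono hv
  rw [← hM] at h2
  rw [Finset.sum_union hdis, ← h2] at h1
  rw [confined_remove]
  have h3 := Finset.sum_sdiff (f := fun i => peakLoad ρ r i v)
    (confined_mono (N := N) (Finset.subset_union_left : M ⊆ M ∪ J'))
  linarith

end Finite

theorem remove_exhausted_of_top (htop : minRatio C ρ r N = ⊤) :
    (N.remove (minimizers C ρ r N)).Exhausted := by
  obtain ⟨h1, h2⟩ := h.users_eq_empty_of_top hm hρ hr hr_mono htop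
  exact ⟨by simp [remove, h1], by simp [remove, h2]⟩

theorem minRatio_cases : minRatio C ρ r N = ⊤ ∨ ∃ v : ℝ, minRatio C ρ r N = v := by
  have := h.first_peak_lt_minRatio hm hρ hr hr_mono
  induction hM : minRatio C ρ r N with
  | bot => rw [hM] at this; simp at this
  | top => exact Or.inl rfl
  | coe v => exact Or.inr ⟨v, rfl⟩

/-- The slack left at rate `v` implies stability, because `peakLoad` dominates `ρ`; users without
remaining routes were confined and have been removed. -/
theorem remove : (N.remove (minimizers C ρ r N)).Admissible C ρ := by
  rcases h.minRatio_cases hm hρ hr hr_mono with htop | ⟨v, hv⟩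
  · exact (h.remove_exhausted_of_top hm hρ hr hr_mono htop).admissible C ρ
  refine ⟨fun i hi => ?_, fun i hi => ?_, fun J' hJ hne => ?_⟩
  · obtain ⟨hu, hc⟩ := Finset.mem_sdiff.1 hi
    refine Finset.sdiff_nonempty.2 fun hsub => hc (mem_confined.2 ⟨hu, hsub⟩)
  · exact Finset.sdiff_subset_sdiff (h.routes_subset i (Finset.mem_sdiff.1 hi).1)
      (Finset.Subset.refl _)
  · exact (Finset.sum_le_sum fun i _ => le_max_left _ _).trans_lt
      (h.sum_peakLoad_remove_lt hm hρ hr hr_mono hv hJ hne)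

/-- The next minimisers are tight at the next rate but have strict slack at the present one, and
loads are monotone in the rate. -/
theorem minRatio_lt_minRatio_remove
    (hne : (N.remove (minimizers C ρ r N)).resources.Nonempty) :
    minRatio C ρ r N < minRatio C ρ r (N.remove (minimizers C ρ r N)) := by
  have h' := h.remove hm hρ hr hr_mono
  rcases h.minRatio_cases hm hρ hr hr_mono with htop | ⟨v, hv⟩
  · exact absurd (h.remove_exhausted_of_top hm hρ hr hr_mono htop).2 hne.ne_empty
  rcases h'.minRatio_cases hm hρ hr hr_mono with htop' | ⟨v', hv'⟩
  · rw [hv, htop']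
    exact EReal.coe_lt_top v
  · rw [hv, hv', EReal.coe_lt_coe_iff]
    by_contra! hle
    have h1 := h'.tight_minimizers hm hρ hr hr_mono hv'
    have h2 := h.sum_peakLoad_remove_lt hm hρ hr hr_mono hv minimizers_subset
      (minimizers_nonempty (C := C) (ρ := ρ) (r := r) hm hne)
    have h3 := Finset.sum_le_sum fun i
      (_ : i ∈ (N.remove (minimizers C ρ r N)).confined
        (minimizers C ρ r (N.remove (minimizers C ρ r N)))) => peakLoad_mono hρ hr i hle
    linarith

end Admissible

end Step

end Network

/-! ### Iteration of the steps, and a fair allocation realising the levels. -/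

section Levels

variable {m : ℕ} {κ : Type*} [Fintype κ] [DecidableEq κ]
  {C : κ → ℝ} {ρ r : Fin m → ℝ} {S : Fin m → Finset κ}

/-- The index of the last member of a decreasing sequence of sets that contains a given element. -/
theorem exists_last_mem {α : Type*} {A : ℕ → Finset α} (hA : Antitone A) {a : α} {K : ℕ}
    (h0 : a ∈ A 0) (hK : a ∉ A K) : ∃ k < K, ∀ l, a ∈ A l ↔ l ≤ k := by
  classical
  have hex : ∃ l, a ∉ A l := ⟨K, hK⟩
  obtain ⟨k, hk⟩ : ∃ k, Nat.find hex = k + 1 :=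
    Nat.exists_eq_succ_of_ne_zero fun h => Nat.find_spec hex (h ▸ h0)
  refine ⟨k, ?_, fun l => ⟨fun hl => ?_, fun hl => ?_⟩⟩
  · have := Nat.find_min' hex hK
    omega
  · by_contra! hlt
    exact Nat.find_spec hex (hA (by omega) hl)
  · by_contra hn
    have := Nat.find_min' hex hn
    omega

theorem networkAt_routes (k : ℕ) (i : Fin m) :
    (networkAt C ρ r S k).routes i = S i ∩ (networkAt C ρ r S k).resources := by
  induction k with
  | zero => exact (Finset.inter_univ _).symm
  | succ k ih =>
    change (networkAt C ρ r S k).routes i \ _ = S i ∩ ((networkAt C ρ r S k).resources \ _)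
    rw [ih, Finset.inter_sdiff_assoc]

theorem antitone_networkAt_users : Antitone fun k => (networkAt C ρ r S k).users :=
  antitone_nat_of_succ_le fun _ => Finset.sdiff_subset

theorem antitone_networkAt_resources : Antitone fun k => (networkAt C ρ r S k).resources :=
  antitone_nat_of_succ_le fun _ => Finset.sdiff_subset

theorem mem_levelUsers {k : ℕ} {i : Fin m} : i ∈ levelUsers C ρ r S k ↔
    i ∈ (networkAt C ρ r S k).users ∧ i ∉ (networkAt C ρ r S (k + 1)).users := by
  change _ ↔ _ ∧ i ∉ (networkAt C ρ r S k).users \ levelUsers C ρ r S k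
  have : i ∈ levelUsers C ρ r S k → i ∈ (networkAt C ρ r S k).users :=
    fun h => (Network.mem_confined.1 h).1
  rw [Finset.mem_sdiff]
  tauto

theorem mem_levelResources {k : ℕ} {j : κ} : j ∈ levelResources C ρ r S k ↔
    j ∈ (networkAt C ρ r S k).resources ∧ j ∉ (networkAt C ρ r S (k + 1)).resources := by
  change _ ↔ _ ∧ j ∉ (networkAt C ρ r S k).resources \ levelResources C ρ r S k
  have : j ∈ levelResources C ρ r S k → j ∈ (networkAt C ρ r S k).resources :=
    fun h => Network.minimizers_subset h
  rw [Finset.mem_sdiff]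
  tauto

theorem exists_exhausted (hm : 0 < m) (hadm : ∀ k, (networkAt C ρ r S k).Admissible C ρ) :
    ∃ K, (networkAt C ρ r S K).Exhausted := by
  by_contra! hex
  have key : ∀ k, (networkAt C ρ r S k).resources.card + k ≤ Fintype.card κ := by
    intro k
    induction k with
    | zero => exact (networkAt C ρ r S 0).resources.card_le_univ
    | succ k ih =>
      have hne := (hadm k).resources_nonempty (hex k)
      have h1 := Network.minimizers_nonempty (C := C) (ρ := ρ) (r := r) hm hne
      have h2 : (networkAt C ρ r S (k + 1)).resources.card <
          (networkAt C ρ r S k).resources.card := by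
        refine Finset.card_lt_card (Finset.sdiff_ssubset Network.minimizers_subset h1)
      omega
  have := key (Fintype.card κ + 1)
  omega

/-- The steps of the algorithm assign to every user and every resource a level, and the levels
have the properties needed to recover the rate allocation. -/
structure IsLevelling (C : κ → ℝ) (ρ r : Fin m → ℝ) (S : Fin m → Finset κ) (hm : 0 < m) (K : ℕ)
    (lu : Fin m → ℕ) (lr : κ → ℕ) : Prop where
  stops : (networkAt C ρ r S K).Exhausted
  continues : ∀ k < K, ¬ (networkAt C ρ r S k).Exhausted
  user_lt : ∀ i, lu i < K
  resource_lt : ∀ j, lr j < K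
  mem_users : ∀ i k, i ∈ levelUsers C ρ r S k ↔ lu i = k
  mem_resources : ∀ j k, j ∈ levelResources C ρ r S k ↔ lr j = k
  exists_resource : ∀ k < K, ∃ j, lr j = k
  rate_lt : ∀ k l, k < l → l < K → levelRate C ρ r S k < levelRate C ρ r S l
  first_peak_lt : ∀ k, (r ⟨0, hm⟩ : EReal) < levelRate C ρ r S k
  rate_ne_top : ∀ i, levelRate C ρ r S (lu i) ≠ ⊤
  route_le : ∀ i, ∀ j ∈ S i, lr j ≤ lu i
  exists_route : ∀ i, ∃ j ∈ S i, lr j = lu i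
  tight : ∀ k, ∀ v : ℝ, levelRate C ρ r S k = v →
    ∑ i ∈ levelUsers C ρ r S k, peakLoad ρ r i v = ∑ j ∈ levelResources C ρ r S k, C j
  load_le : ∀ k, ∀ v : ℝ, levelRate C ρ r S k = v → ∀ R : Finset κ,
    ∑ i ∈ (levelUsers C ρ r S k).filter (fun i => (S i).filter (fun j => lr j = k) ⊆ R),
      peakLoad ρ r i v ≤ ∑ j ∈ R.filter (fun j => lr j = k), C j

theorem exists_isLevelling (hm : 0 < m) (hρ : ∀ i, 0 < ρ i) (hr : ∀ i, 0 < r i)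
    (hr_mono : Monotone r) (h0 : (fullNetwork S).Admissible C ρ) :
    ∃ K lu lr, IsLevelling C ρ r S hm K lu lr := by
  classical
  have hadm : ∀ k, (networkAt C ρ r S k).Admissible C ρ := by
    intro k
    induction k with
    | zero => exact h0
    | succ k ih => exact ih.remove hm hρ hr hr_mono
  have hex := exists_exhausted hm hadm
  set K := Nat.find hex
  have hK : (networkAt C ρ r S K).Exhausted := Nat.find_spec hex
  have hcont : ∀ k < K, ¬ (networkAt C ρ r S k).Exhausted := fun k hk => Nat.find_min hex hk
  -- The level of a user or a resource is the last step at whose beginning it is still present.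
  choose lu hlu husers using fun i : Fin m => exists_last_mem (a := i) (K := K)
    (antitone_networkAt_users (C := C) (ρ := ρ) (r := r) (S := S)) (Finset.mem_univ i)
    (by simp [hK.1])
  choose lr hlr hres using fun j : κ => exists_last_mem (a := j) (K := K)
    (antitone_networkAt_resources (C := C) (ρ := ρ) (r := r) (S := S)) (Finset.mem_univ j)
    (by simp [hK.2])
  have memU : ∀ i k, i ∈ levelUsers C ρ r S k ↔ lu i = k := fun i k => by
    rw [mem_levelUsers, husers, husers]; omega
  have memR : ∀ j k, j ∈ levelResources C ρ r S k ↔ lr j = k := fun j k => by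
    rw [mem_levelResources, hres, hres]; omega
  have hroute : ∀ i, S i ∩ (networkAt C ρ r S (lu i)).resources ⊆ levelResources C ρ r S (lu i) := by
    intro i
    rw [← networkAt_routes]
    exact (Network.mem_confined.1 ((memU i _).2 rfl)).2
  have hstep : ∀ k, k + 1 < K → levelRate C ρ r S k < levelRate C ρ r S (k + 1) := fun k hk =>
    (hadm k).minRatio_lt_minRatio_remove hm hρ hr hr_mono
      ((hadm (k + 1)).resources_nonempty (hcont _ hk))
  refine ⟨K, lu, lr, hK, hcont, hlu, hlr, memU, memR, fun k hk => ?_, fun k l hkl => ?_,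
    fun k => (hadm k).first_peak_lt_minRatio hm hρ hr hr_mono, fun i htop => ?_,
    fun i j hj => ?_, fun i => ?_, fun k v hv => ?_, fun k v hv R => ?_⟩
  · obtain ⟨j, hj⟩ := Network.minimizers_nonempty (C := C) (ρ := ρ) (r := r) hm
      ((hadm k).resources_nonempty (hcont k hk))
    exact ⟨j, (memR j k).1 hj⟩
  · induction l, hkl using Nat.le_induction with
    | base => exact hstep k
    | succ l hl ih => exact fun hlK => (ih (by omega)).trans (hstep l hlK)
  · have h1 := ((hadm (lu i)).users_eq_empty_of_top hm hρ hr hr_mono htop).1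
    have h2 := (husers i (lu i)).2 le_rfl
    simp [h1] at h2
  -- A resource of a later level would still be present when `i` is removed, and so would be removed
  -- along with it.
  · by_contra! hlt
    have h1 := hroute i (Finset.mem_inter.2 ⟨hj, (hres j _).2 hlt.le⟩)
    exact hlt.ne' ((memR j _).1 h1)
  · obtain ⟨j, hj⟩ := (hadm (lu i)).routes_nonempty i ((husers i _).2 le_rfl)
    rw [networkAt_routes] at hj
    exact ⟨j, (Finset.mem_inter.1 hj).1, (memR j _).1 (hroute i hj)⟩
  · exact (hadm k).tight_minimizers hm hρ hr hr_mono hv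
  · have hsub : R.filter (fun j => lr j = k) ⊆ (networkAt C ρ r S k).resources := fun j hj =>
      (hres j k).2 (Finset.mem_filter.1 hj).2.ge
    refine le_trans ?_ ((hadm k).sum_peakLoad_le hm hρ hr hr_mono hv hsub)
    refine Finset.sum_le_sum_of_subset_of_nonneg (fun i hi => ?_)
      fun i _ _ => (hρ i).le.trans (le_max_left _ _)
    obtain ⟨hi, hiR⟩ := Finset.mem_filter.1 hi
    have hk := (memU i k).1 hi
    subst hk
    refine Network.mem_confined.2 ⟨(husers i _).2 le_rfl, fun j hj => ?_⟩
    rw [networkAt_routes] at hj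
    have hjk := (memR j _).1 (hroute i hj)
    exact Finset.mem_filter.2
      ⟨hiR (Finset.mem_filter.2 ⟨(Finset.mem_inter.1 hj).1, hjk⟩), hjk⟩

namespace IsLevelling

variable {hm : 0 < m} {K : ℕ} {lu : Fin m → ℕ} {lr : κ → ℕ}

theorem levelRate_inj (h : IsLevelling C ρ r S hm K lu lr) {k l : ℕ} (hk : k < K) (hl : l < K)
    (heq : levelRate C ρ r S k = levelRate C ρ r S l) : k = l := by
  rcases lt_trichotomy k l with hlt | rfl | hlt
  · exact absurd heq (h.rate_lt k l hlt hl).ne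
  · rfl
  · exact absurd heq (h.rate_lt l k hlt hk).ne'

theorem coe_toReal (h : IsLevelling C ρ r S hm K lu lr) {k : ℕ}
    (hk : levelRate C ρ r S k ≠ ⊤) :
    ((levelRate C ρ r S k).toReal : EReal) = levelRate C ρ r S k :=
  EReal.coe_toReal hk (bot_lt_iff_ne_bot.1 (bot_le.trans_lt (h.first_peak_lt k)))

theorem le_of_toReal_le (h : IsLevelling C ρ r S hm K lu lr) {i i' : Fin m}
    (hle : (levelRate C ρ r S (lu i)).toReal ≤ (levelRate C ρ r S (lu i')).toReal) :
    lu i ≤ lu i' := by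
  by_contra! hlt
  have := h.rate_lt _ _ hlt (h.user_lt i)
  rw [← h.coe_toReal (h.rate_ne_top i), ← h.coe_toReal (h.rate_ne_top i'),
    EReal.coe_lt_coe_iff] at this
  exact absurd hle (not_le.2 this)

theorem toReal_le (h : IsLevelling C ρ r S hm K lu lr) {i i' : Fin m} (hle : lu i ≤ lu i') :
    (levelRate C ρ r S (lu i)).toReal ≤ (levelRate C ρ r S (lu i')).toReal := by
  rcases hle.eq_or_lt with heq | hlt
  · rw [heq]
  · have := h.rate_lt _ _ hlt (h.user_lt i')
    rw [← h.coe_toReal (h.rate_ne_top i), ← h.coe_toReal (h.rate_ne_top i'),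
      EReal.coe_lt_coe_iff] at this
    exact this.le

/-- The rates found by the algorithm can be realised by routing all traffic within the levels. -/
theorem exists_isFairAllocation (h : IsLevelling C ρ r S hm K lu lr) (hC : ∀ j, 0 < C j)
    (hr : ∀ i, 0 < r i) {n x : Fin m → ℝ} (hn : ∀ i, 0 < n i)
    (hx : ∀ i, x i = (levelRate C ρ r S (lu i)).toReal)
    (hload : ∀ i, n i * x i = peakLoad ρ r i (x i)) :
    ∃ y, IsFairAllocation C S n x y ∧ (∀ i j, 0 < y i j → lr j = lu i) ∧
      ∀ j, levelRate C ρ r S (lr j) ≠ ⊤ → ∑ i, n i * y i j = C j := by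
  have hcoe : ∀ i, (x i : EReal) = levelRate C ρ r S (lu i) := fun i => by
    rw [hx, h.coe_toReal (h.rate_ne_top i)]
  have hpos : ∀ i, 0 < x i := fun i => by
    have := h.first_peak_lt (lu i)
    rw [← hcoe, EReal.coe_lt_coe_iff] at this
    exact (hr _).trans this
  set T : Fin m → Finset κ := fun i => (S i).filter fun j => lr j = lu i with hT
  have hT' : ∀ i j, j ∈ T i ↔ j ∈ S i ∧ lr j = lu i := fun i j => by simp [hT]
  obtain ⟨z, hz0, hz1, hz2, hz3⟩ := exists_transport hC (T := T) (d := fun i => n i * x i)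
    (fun i => by
      obtain ⟨j, hj, hl⟩ := h.exists_route i
      exact ⟨j, (hT' i j).2 ⟨hj, hl⟩⟩)
    (fun i => (mul_pos (hn i) (hpos i)).le) (fun R => by
      -- As `T i` lies in the level of `i`, Hall's condition splits into one inequality per level.
      rw [← Finset.sum_fiberwise_of_maps_to (s := Finset.univ.filter fun i => T i ⊆ R)
          (t := Finset.range K) (g := lu) fun i _ => Finset.mem_range.2 (h.user_lt i),
        ← Finset.sum_fiberwise_of_maps_to (s := R)
          (t := Finset.range K) (g := lr) fun j _ => Finset.mem_range.2 (h.resource_lt j)]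
      refine Finset.sum_le_sum fun k _ => ?_
      by_cases hk : ∃ i, lu i = k
      · obtain ⟨i₀, rfl⟩ := hk
        refine le_trans (le_of_eq ?_) (h.load_le _ _ (hcoe i₀).symm R)
        refine Finset.sum_congr ?_ fun i hi => ?_
        · ext i
          simp only [Finset.mem_filter, Finset.mem_univ, true_and, h.mem_users, hT]
          constructor
          · rintro ⟨h1, h2⟩; rw [h2] at h1; exact ⟨h2, h1⟩
          · rintro ⟨h1, h2⟩; rw [h1]; exact ⟨h2, rfl⟩
        · have hi' : lu i = lu i₀ := (h.mem_users i _).1 (Finset.mem_filter.1 hi).1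
          rw [hload, hx i, hi', ← hx i₀]
      · rw [Finset.sum_eq_zero fun i hi => absurd ⟨i, (Finset.mem_filter.1 hi).2⟩ hk]
        exact Finset.sum_nonneg fun j _ => (hC j).le)
  have hny : ∀ i j, n i * (z i j / n i) = z i j := fun i j => mul_div_cancel₀ _ (hn i).ne'
  have hlev : ∀ i j, 0 < z i j / n i → lr j = lu i := fun i j hy => by
    by_contra hne
    rw [hz1 i j fun hj => hne ((hT' i j).1 hj).2, zero_div] at hy
    exact lt_irrefl _ hy
  have hfeas : IsFeasible C S n x fun i j => z i j / n i := by
    refine ⟨fun i j => div_nonneg (hz0 i j) (hn i).le, fun i j hj => ?_, fun j => ?_, fun i => ?_⟩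
    · rw [hz1 i j fun hj' => hj ((hT' i j).1 hj').1, zero_div]
    · simp only [hny]
      exact hz3 j
    · rw [← Finset.sum_div, div_eq_iff (hn i).ne', mul_comm, ← hz2 i]
      exact (Finset.sum_subset (Finset.filter_subset _ _) fun j _ hj => hz1 i j hj).symm
  -- The traffic of a level of finite rate equals its total capacity, so no single capacity
  -- constraint in it can be slack.
  have hsat : ∀ j, levelRate C ρ r S (lr j) ≠ ⊤ → ∑ i, n i * (z i j / n i) = C j := by
    intro j hj
    have hv := (h.coe_toReal hj).symm
    have h1 := h.tight _ _ hv
    have h2 := hfeas.sum_users_eq_load (A := levelUsers C ρ r S (lr j))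
      (B := levelResources C ρ r S (lr j))
      (fun i hi j' hy => (h.mem_resources _ _).2 ((hlev i j' hy).trans ((h.mem_users _ _).1 hi)))
      (fun j' hj' i hy => (h.mem_users _ _).2
        ((hlev i j' hy).symm.trans ((h.mem_resources _ _).1 hj')))
    have h3 : ∑ i ∈ levelUsers C ρ r S (lr j), n i * x i =
        ∑ i ∈ levelUsers C ρ r S (lr j), peakLoad ρ r i (levelRate C ρ r S (lr j)).toReal := by
      refine Finset.sum_congr rfl fun i hi => ?_
      rw [hload, hx, (h.mem_users _ _).1 hi]
    exact (Finset.sum_eq_sum_iff_of_le fun j' _ => hfeas.capacity j').1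
      (h2.symm.trans (h3.trans h1)) j ((h.mem_resources _ _).2 rfl)
  refine ⟨fun i j => z i j / n i, ⟨hfeas, hpos, fun i j hj => hsat j ?_, fun i j hj i' hy => ?_⟩,
    hlev, hsat⟩
  · rcases (h.route_le i j hj).eq_or_lt with heq | hlt
    · rw [heq]; exact h.rate_ne_top i
    · exact ((h.rate_lt _ _ hlt (h.user_lt i)).trans_le le_top).ne
  · rw [hx, hx]
    exact h.toReal_le ((hlev i' j hy).symm.trans_le (h.route_le i j hj))

end IsLevelling

/-- The index is the largest one with peak rate below `v`. Among equal peak rates only the last can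
satisfy both inequalities, which gives uniqueness despite ties. -/
theorem exists_threshold (hm : 0 < m) (hr_mono : Monotone r) {v : EReal}
    (hv : (r ⟨0, hm⟩ : EReal) < v) :
    ∃ s : Fin m, (∀ i, (r i : EReal) < v ↔ i ≤ s) ∧
      ∀ i, ((r i : EReal) < v ∧ v ≤ nextPeak r i) ↔ i = s := by
  classical
  obtain ⟨s, hs, hmax⟩ := Finset.exists_max_image
    (Finset.univ.filter fun i => (r i : EReal) < v) id
    ⟨⟨0, hm⟩, Finset.mem_filter.2 ⟨Finset.mem_univ _, hv⟩⟩
  have hs : (r s : EReal) < v := (Finset.mem_filter.1 hs).2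
  have hiff : ∀ i, (r i : EReal) < v ↔ i ≤ s := fun i =>
    ⟨fun hi => hmax i (Finset.mem_filter.2 ⟨Finset.mem_univ _, hi⟩),
      fun hi => (EReal.coe_le_coe_iff.2 (hr_mono hi)).trans_lt hs⟩
  refine ⟨s, hiff, fun i => ⟨fun ⟨h1, h2⟩ => ?_, ?_⟩⟩
  · refine le_antisymm ((hiff i).1 h1) (le_of_not_gt fun hlt => ?_)
    have hi : (i : ℕ) + 1 < m := by have := s.2; have : (i : ℕ) < s := hlt; omega
    rw [nextPeak, dif_pos hi] at h2
    have h3 : (⟨(i : ℕ) + 1, hi⟩ : Fin m) ≤ s := Fin.mk_le_of_le_val (Nat.succ_le_of_lt hlt)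
    exact absurd h2 (not_le.2 ((hiff _).2 h3))
  · rintro rfl
    refine ⟨hs, ?_⟩
    unfold nextPeak
    split_ifs with hi
    · refine le_of_not_gt fun hlt => ?_
      have : (⟨(i : ℕ) + 1, hi⟩ : Fin m) ≤ i := (hiff _).1 hlt
      have : (i : ℕ) + 1 ≤ i := this
      omega
    · exact le_top

end Levels

/-! ### Clusters and cluster levels, given that flow edges stay within levels. -/

section Clusters

variable {m : ℕ} {κ : Type*} [Fintype κ] [DecidableEq κ] {U : ℝ → ℝ}
  {C : κ → ℝ} {ρ r : Fin m → ℝ} {S : Fin m → Finset κ} {hm : 0 < m} {K : ℕ}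
  {lu : Fin m → ℕ} {lr : κ → ℕ} {n : Fin m → ℝ}

theorem flowGraph_adj {i : Fin m} {j : κ} :
    (flowGraph U C S n).Adj (Sum.inl i) (Sum.inr j) ↔
      ∃ x y, IsOptimal U C S n x y ∧ 0 < y i j := by
  simp [flowGraph]

theorem exists_component (U : ℝ → ℝ) (C : κ → ℝ) (S : Fin m → Finset κ) (n : Fin m → ℝ)
    (v : Fin m ⊕ κ) : ∃ (A : Finset (Fin m)) (B : Finset κ),
      (∀ i, i ∈ A ↔ (flowGraph U C S n).Reachable v (Sum.inl i)) ∧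
      (∀ j, j ∈ B ↔ (flowGraph U C S n).Reachable v (Sum.inr j)) := by
  classical
  have h1 : ∀ i, i ∈ Finset.univ.filter (fun i => (flowGraph U C S n).Reachable v (Sum.inl i)) ↔
      (flowGraph U C S n).Reachable v (Sum.inl i) := by simp
  have h2 : ∀ j, j ∈ Finset.univ.filter (fun j => (flowGraph U C S n).Reachable v (Sum.inr j)) ↔
      (flowGraph U C S n).Reachable v (Sum.inr j) := by simp
  exact ⟨_, _, h1, h2⟩

namespace IsLevelling

variable (h : IsLevelling C ρ r S hm K lu lr)
  (hrate : ∀ i, (rateAllocation U C S n i : EReal) = levelRate C ρ r S (lu i))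
  (hadj : ∀ i j, (flowGraph U C S n).Adj (Sum.inl i) (Sum.inr j) → lr j = lu i)
  (hex : ∀ j, levelRate C ρ r S (lr j) ≠ ⊤ →
    ∃ i, (flowGraph U C S n).Adj (Sum.inl i) (Sum.inr j))

include hadj in
theorem level_eq_of_reachable {v w : Fin m ⊕ κ} (hvw : (flowGraph U C S n).Reachable v w) :
    Sum.elim lu lr v = Sum.elim lu lr w := by
  obtain ⟨p⟩ := hvw
  induction p with
  | nil => rfl
  | @cons a b c hab _ ih =>
    refine Eq.trans ?_ ih
    rcases a with i | j <;> rcases b with i' | j'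
    · simp [flowGraph] at hab
    · exact (hadj i j' hab).symm
    · exact hadj i' j hab.symm
    · simp [flowGraph] at hab

include hrate hadj hex in
theorem isClusterOfRate_of_reachable {A : Finset (Fin m)} {B : Finset κ} {v : Fin m ⊕ κ}
    (hA : ∀ i, i ∈ A ↔ (flowGraph U C S n).Reachable v (Sum.inl i))
    (hB : ∀ j, j ∈ B ↔ (flowGraph U C S n).Reachable v (Sum.inr j)) :
    IsClusterOfRate U C S n (levelRate C ρ r S (Sum.elim lu lr v)) A B := by
  refine ⟨⟨v, hA, hB⟩, fun i hi => ?_, fun hemp => ?_⟩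
  · have h1 := level_eq_of_reachable hadj ((hA i).1 hi)
    rw [hrate, h1, Sum.elim_inl]
  · subst hemp
    rcases v with i | j
    · exact absurd ((hA i).2 (SimpleGraph.Reachable.refl _)) (Finset.notMem_empty i)
    -- An isolated resource must lie in a level of infinite rate, in accordance with the convention
    -- for clusters without flows.
    · by_contra hne
      obtain ⟨i, hi⟩ := hex j hne
      exact absurd ((hA i).2 hi.symm.reachable) (Finset.notMem_empty i)

include hrate hadj hex in
theorem rate_eq_of_isClusterOfRate {A : Finset (Fin m)} {B : Finset κ} {w : EReal}
    (hw : IsClusterOfRate U C S n w A B) :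
    (∀ i ∈ A, w = levelRate C ρ r S (lu i)) ∧ ∀ j ∈ B, w = levelRate C ρ r S (lr j) := by
  obtain ⟨⟨v, hA, hB⟩, h1, h2⟩ := hw
  have h3 := isClusterOfRate_of_reachable hrate hadj hex hA hB
  have hwv : w = levelRate C ρ r S (Sum.elim lu lr v) := by
    rcases A.eq_empty_or_nonempty with hemp | ⟨i, hi⟩
    · rw [h2 hemp, h3.2.2 hemp]
    · rw [← h1 i hi, h3.2.1 i hi]
  refine ⟨fun i hi => ?_, fun j hj => ?_⟩
  · rw [hwv, level_eq_of_reachable hadj ((hA i).1 hi), Sum.elim_inl]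
  · rw [hwv, level_eq_of_reachable hadj ((hB j).1 hj), Sum.elim_inr]

include h hrate hadj hex in
theorem isClusterLevel {k : ℕ} (hk : k < K) : IsClusterLevel U C S n (levelRate C ρ r S k)
    (levelUsers C ρ r S k) (levelResources C ρ r S k) := by
  refine ⟨?_, fun i => ?_, fun j => ?_⟩
  · obtain ⟨j, rfl⟩ := h.exists_resource k hk
    obtain ⟨A, B, hA, hB⟩ := exists_component U C S n (Sum.inr j)
    have hAB := isClusterOfRate_of_reachable hrate hadj hex hA hB
    rw [Sum.elim_inr] at hAB
    exact ⟨A, B, hAB⟩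
  · rw [h.mem_users]
    constructor
    · rintro rfl
      obtain ⟨A, B, hA, hB⟩ := exists_component U C S n (Sum.inl i)
      have hAB := isClusterOfRate_of_reachable hrate hadj hex hA hB
      rw [Sum.elim_inl] at hAB
      exact ⟨A, B, hAB, (hA i).2 (SimpleGraph.Reachable.refl _)⟩
    · rintro ⟨A, B, hAB, hi⟩
      exact h.levelRate_inj (h.user_lt i) hk
        ((rate_eq_of_isClusterOfRate hrate hadj hex hAB).1 i hi).symm
  · rw [h.mem_resources]
    constructor
    · rintro rfl
      obtain ⟨A, B, hA, hB⟩ := exists_component U C S n (Sum.inr j)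
      have hAB := isClusterOfRate_of_reachable hrate hadj hex hA hB
      rw [Sum.elim_inr] at hAB
      exact ⟨A, B, hAB, (hB j).2 (SimpleGraph.Reachable.refl _)⟩
    · rintro ⟨A, B, hAB, hj⟩
      exact h.levelRate_inj (h.resource_lt j) hk
        ((rate_eq_of_isClusterOfRate hrate hadj hex hAB).2 j hj).symm

include h hrate hadj hex in
theorem exists_level_of_isCluster {A : Finset (Fin m)} {B : Finset κ}
    (hAB : IsCluster U C S n A B) :
    ∃ k < K, IsClusterOfRate U C S n (levelRate C ρ r S k) A B := by
  obtain ⟨v, hA, hB⟩ := hAB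
  refine ⟨Sum.elim lu lr v, ?_, isClusterOfRate_of_reachable hrate hadj hex hA hB⟩
  rcases v with i | j
  · exact h.user_lt i
  · exact h.resource_lt j

end IsLevelling

end Clusters

/-! ### Equilibria of the fluid model, and the theorem. -/

section Equilibrium

variable {ι κ : Type*} [Fintype ι] [Fintype κ] [DecidableEq κ] {U : ℝ → ℝ}
  {C : κ → ℝ} {S : ι → Finset κ} {lam mu r n : ι → ℝ}

theorem isEquilibrium_iff : IsEquilibrium U C S lam mu r n ↔
    (∀ i, 0 ≤ n i) ∧ ∀ i, mu i * n i * min (rateAllocation U C S n i) (r i) = lam i := by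
  constructor
  · intro h
    obtain ⟨h0, hder⟩ := h 0 le_rfl
    have := (uniqueDiffOn_Ici (0 : ℝ) 0 Set.self_mem_Ici).eq_deriv _ hder
      (hasDerivWithinAt_const (0 : ℝ) (Set.Ici 0) n)
    refine ⟨h0, fun i => ?_⟩
    have := congrFun this i
    simp only [fluidDrift, Pi.zero_apply] at this
    linarith
  · rintro ⟨h0, hz⟩ t -
    refine ⟨h0, ?_⟩
    have : fluidDrift U C S lam mu r n = 0 := by
      ext i
      simp [fluidDrift, hz]
    rw [this]
    exact hasDerivWithinAt_const _ _ _

end Equilibrium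

theorem theorem4 {m : ℕ} (hm : 0 < m) {κ : Type*} [Fintype κ] [DecidableEq κ]
    (C : κ → ℝ) (S : Fin m → Finset κ) (hS : ∀ i, (S i).Nonempty)
    (U : ℝ → ℝ) (hU_concave : StrictConcaveOn ℝ (Set.Ioi 0) U)
    (hU_mono : StrictMonoOn U (Set.Ioi 0)) (hU_diff : DifferentiableOn ℝ U (Set.Ioi 0))
    (lam mu r ρ : Fin m → ℝ) (hlam : ∀ i, 0 < lam i) (hmu : ∀ i, 0 < mu i)
    (hρ : ∀ i, ρ i = lam i / mu i) (hr : ∀ i, 0 < r i) (hr_mono : Monotone r)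
    (hstable : ∀ J' : Finset κ, (fullNetwork S).IsStronglyConn J' →
      ∑ i ∈ (fullNetwork S).confined J', ρ i < ∑ j ∈ J', C j)
    (hne : ∀ J' : Finset κ, (fullNetwork S).IsConn J' → ∀ I' : Finset (Fin m),
      (fullNetwork S).confined J' ⊂ I' → I' ⊆ (fullNetwork S).touching J' →
      ∑ i ∈ I', ρ i ≠ ∑ j ∈ J', C j) :
    ∃ (K : ℕ) (istar : ℕ → Fin m) (x n : Fin m → ℝ),
      -- the algorithm terminates, is well defined and returns `x` and `n`
      IsAlgorithmOutput C ρ r S K istar x n ∧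
      -- `n` is the unique equilibrium point of the fluid limit
      (∀ n' : Fin m → ℝ, IsEquilibrium U C S lam mu r n' ↔ n' = n) ∧
      -- `x` is the rate allocation at `n`, the unique vector of optimal rates
      rateAllocation U C S n = x ∧
      (∀ x' : Fin m → ℝ, (∃ y, IsOptimal U C S n x' y) ↔ x' = x) ∧
      -- the successive steps give the cluster levels at `n`, in increasing order of the rate
      (∀ k < K, IsClusterLevel U C S n (levelRate C ρ r S k)
        (levelUsers C ρ r S k) (levelResources C ρ r S k)) ∧
      (∀ k l, k < l → l < K → levelRate C ρ r S k < levelRate C ρ r S l) ∧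
      (∀ A B, IsCluster U C S n A B →
        ∃ k < K, IsClusterOfRate U C S n (levelRate C ρ r S k) A B) ∧
      -- the peak-rate constrained flow types are exactly those of `I* = ⋃ₖ {i ∈ Iₖ : i ≤ iₖ*}`
      (∀ i, r i < rateAllocation U C S n i ↔
        ∃ k < K, i ∈ levelUsers C ρ r S k ∧ i ≤ istar k) := by
  have hρ0 : ∀ i, 0 < ρ i := fun i => by rw [hρ]; exact div_pos (hlam i) (hmu i)
  -- Singletons are strongly connected, so stability makes every capacity positive.
  have hC : ∀ j, 0 < C j := fun j =>
    (Finset.sum_nonneg fun i _ => (hρ0 i).le).trans_lt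
      ((hstable {j} (Network.isStronglyConn_singleton (Finset.mem_univ j))).trans_eq
        (Finset.sum_singleton C j))
  have hadm : (fullNetwork S).Admissible C ρ := ⟨fun i _ => hS i, fun i _ => Finset.subset_univ _,
    Network.sum_confined_lt (fun i _ => hS i) hstable⟩
  -- Stability covers the case `I' = I(J')`, which nondegeneracy leaves out.
  have hbal : ∀ J', (fullNetwork S).IsConn J' → ∀ I' : Finset (Fin m),
      (fullNetwork S).confined J' ⊆ I' → I' ⊆ (fullNetwork S).touching J' →
      ∑ i ∈ I', ρ i ≠ ∑ j ∈ J', C j := by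
    intro J' hJ I' hsub htouch
    rcases hsub.eq_or_ssubset with rfl | hss
    · exact (hadm.stable J' hJ.1 hJ.2.1).ne
    · exact hne J' hJ I' hss htouch
  obtain ⟨K, lu, lr, h⟩ := exists_isLevelling hm hρ0 hr hr_mono hadm
  choose istar hlt hthr using fun k => exists_threshold hm hr_mono (h.first_peak_lt k)
  set x : Fin m → ℝ := fun i => (levelRate C ρ r S (lu i)).toReal with hx
  have hcoe : ∀ i, (x i : EReal) = levelRate C ρ r S (lu i) :=
    fun i => h.coe_toReal (h.rate_ne_top i)
  have hpeak : ∀ i, r i < x i ↔ i ≤ istar (lu i) := fun i => by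
    rw [← hlt, ← hcoe, EReal.coe_lt_coe_iff]
  have hxpos : ∀ i, 0 < x i := fun i => by
    have := h.first_peak_lt (lu i)
    rw [← hcoe, EReal.coe_lt_coe_iff] at this
    exact (hr _).trans this
  have hmin : ∀ i, 0 < min (x i) (r i) := fun i => lt_min (hxpos i) (hr i)
  set n : Fin m → ℝ := fun i => ρ i / min (x i) (r i) with hn
  have hnpos : ∀ i, 0 < n i := fun i => div_pos (hρ0 i) (hmin i)
  have hnmin : ∀ i, n i * min (x i) (r i) = ρ i := fun i => div_mul_cancel₀ _ (hmin i).ne'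
  have hload : ∀ i, n i * x i = peakLoad ρ r i (x i) := fun i =>
    mul_rate_eq_peakLoad (hρ0 i) (hr i) (hnmin i)
  obtain ⟨y, hy, hylev, hysat⟩ :=
    h.exists_isFairAllocation hC hr hnpos (fun i => rfl) hload
  have hopt : IsOptimal U C S n x y := hy.isOptimal hC hnpos hU_concave hU_mono hU_diff
  have huniq : ∀ {x' y'}, IsOptimal U C S n x' y' → x' = x :=
    hy.rate_unique hC hnpos hU_concave hU_mono hU_diff
  have halloc : rateAllocation U C S n = x :=
    hy.rateAllocation_eq hC hnpos hU_concave hU_mono hU_diff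
  have hrate : ∀ i, (rateAllocation U C S n i : EReal) = levelRate C ρ r S (lu i) := fun i => by
    rw [halloc, hcoe]
  -- Another optimal routing `y'` has the same rates and is fair. In `y` the resource `j` is used by
  -- some `i₀` of its own level, and fairness of `y'` at `j` gives `x i ≤ x i₀`, so `i` is not of a
  -- later level.
  have hadj : ∀ i j, (flowGraph U C S n).Adj (Sum.inl i) (Sum.inr j) → lr j = lu i := by
    intro i j hij
    obtain ⟨x', y', hopt', hij⟩ := flowGraph_adj.1 hij
    obtain rfl := huniq hopt'
    have hy' := hopt'.isFairAllocation hU_concave hU_mono hnpos hxpos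
    have hj := hy'.mem_of_pos hij
    refine le_antisymm (h.route_le i j hj) ?_
    obtain ⟨i₀, hi₀⟩ := hy.exists_user hC hj
    rw [hylev i₀ j hi₀]
    exact h.le_of_toReal_le (hy'.fair i₀ j (hy.mem_of_pos hi₀) i hij)
  have hex : ∀ j, levelRate C ρ r S (lr j) ≠ ⊤ →
      ∃ i, (flowGraph U C S n).Adj (Sum.inl i) (Sum.inr j) := by
    intro j hj
    by_contra! hno
    have h0 : ∀ i, y i j = 0 := fun i => le_antisymm
      (le_of_not_gt fun hij => hno i (flowGraph_adj.2 ⟨x, y, hopt, hij⟩)) (hy.feasible.nonneg i j)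
    have := hysat j hj
    simp only [h0, mul_zero, Finset.sum_const_zero] at this
    exact (hC j).ne this
  refine ⟨K, istar, x, n, ⟨h.stops, h.continues, fun k _ => hthr k, fun k _ i hi => ?_,
    fun k _ i hi hle => ?_, fun k _ i hi hgt => ?_⟩, fun n' => ⟨fun heq => ?_, ?_⟩, halloc,
    fun x' => ⟨fun ⟨y', hy'⟩ => huniq hy', ?_⟩, fun k hk => h.isClusterLevel hrate hadj hex hk,
    h.rate_lt, fun A B hAB => h.exists_level_of_isCluster hrate hadj hex hAB, fun i => ?_⟩
  · rw [hcoe, (h.mem_users i k).1 hi]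
  · obtain rfl := (h.mem_users i k).1 hi
    simp only [hn]
    rw [min_eq_right ((hpeak i).2 hle).le]
  · obtain rfl := (h.mem_users i k).1 hi
    simp only [hn]
    rw [min_eq_left (not_lt.1 fun hlt' => absurd ((hpeak i).1 hlt') (not_le.2 hgt))]
  · obtain ⟨hn0, hdrift⟩ := isEquilibrium_iff.1 heq
    have hflow : ∀ i, n' i * min (rateAllocation U C S n' i) (r i) = ρ i := fun i => by
      rw [hρ, ← hdrift i, mul_assoc, mul_div_cancel_left₀ _ (hmu i).ne']
    have hn'pos : ∀ i, 0 < n' i := fun i => by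
      refine lt_of_le_of_ne (hn0 i) fun h0 => ?_
      have := hflow i
      rw [← h0, zero_mul] at this
      exact (hρ0 i).ne this
    have hmin' : ∀ i, 0 < min (rateAllocation U C S n' i) (r i) := fun i => by
      have := hρ0 i
      rw [← hflow i] at this
      exact pos_of_mul_pos_right this (hn0 i)
    have hx'pos : ∀ i, 0 < rateAllocation U C S n' i := fun i => (hmin' i).trans_le (min_le_left _ _)
    -- Without a solution the allocation would have its default value zero, whereas equilibrium
    -- rates are positive.
    have hsol : ∃ y', IsOptimal U C S n' (rateAllocation U C S n') y' := by
      by_cases hsol : ∃ x', ∃ y', IsOptimal U C S n' x' y'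
      · rw [rateAllocation, dif_pos hsol]
        exact hsol.choose_spec
      · have := hx'pos ⟨0, hm⟩
        rw [rateAllocation, dif_neg hsol] at this
        exact absurd this (lt_irrefl 0)
    obtain ⟨y', hy'⟩ := hsol
    have hfair' := hy'.isFairAllocation hU_concave hU_mono hn'pos hx'pos
    have hxx := hfair'.equilibrium_rate_unique hy hC hn'pos hnpos hρ0 hr
      (fun i => mul_rate_eq_peakLoad (hρ0 i) (hr i) (hflow i)) hload hbal
    ext i
    rw [hn, eq_div_iff (hmin i).ne']
    have := hflow i
    rw [hxx] at this
    exact this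
  · rintro rfl
    refine isEquilibrium_iff.2 ⟨fun i => (hnpos i).le, fun i => ?_⟩
    rw [halloc, mul_assoc, hnmin, hρ, mul_div_cancel₀ _ (hmu i).ne']
  · rintro rfl
    exact ⟨y, hopt⟩
  · rw [halloc, hpeak]
    constructor
    · exact fun hi => ⟨lu i, h.user_lt i, (h.mem_users i _).2 rfl, hi⟩
    · rintro ⟨k, -, hi, hle⟩
      rwa [(h.mem_users i k).1 hi]
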